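/- For $\theta=(\mu,\sigma^2,\lambda_1,\lambda_2,\lambda_3)\in\mathbb{R}^5$ and $t=(t_1,t_2)\in[0,1]^2$ put $\lambda=\lambda(t;\theta)=\lambda_1(t_1-1)+\lambda_2(t_2-1)+\lambda_3(t_1t_2-1)$, $\eta=\mu+\sigma^2\lambda$ and $v(t;\theta)=\exp\left(\mu\lambda+\tfrac12\sigma^2\lambda^2\right)$. Let $$\Theta=\{(\mu,\sigma^2,\lambda_1,\lambda_2,\lambda_3)\in\mathbb{R}^5:\ \sigma^2\ge 0,\ \mu>\sigma^2(\lambda_i+\lambda_3),\ \lambda_i>\lambda_3\ge 0,\ i=1,2\}.$$ The bivariate Hermite law $BH(\theta)$ is the law on $\mathbb{N}_0^2$ obtained by mixing the bivariate Poisson distribution with parameters $\delta\lambda_1,\delta\lambda_2,\delta\lambda_3$ over $\delta\sim N(\mu,\sigma^2)$ (the mixture formula $\int p_\delta(r,s)\,dN(\mu,\sigma^2)(\delta)$ for the point probabilities, whenever it defines a probability law, where $p_\delta$ denotes the bivariate Poisson probability formula, used for all real $\delta$); its probability generating function is $v(\cdot;\theta)$. **Theorem.** Let $\theta\in\Theta$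 be such that $BH(\theta)$ exists, let $X_1,X_2,\ldots$, with $X_i=(X_{i1},X_{i2})$, be iid random vectors with law $BH(\theta)$ on a probability space $(\Omega,\mathcal{A},P)$, and let $w\ge 0$ be a measurable function on $[0,1]^2$ with $\int_0^1\int_0^1 w(t)\,dt<\infty$. Let $\hat\theta_n=\hat\theta_n(X_1,\ldots,X_n)\in\mathbb{R}^5$ be estimators such that $$\sqrt n(\hat\theta_n-\theta)=\frac1{\sqrt n}\sum_{i=1}^n\ell(X_i;\theta)+o_P(1),$$ where $\ell:\mathbb{N}_0^2\times\Theta\to\mathbb{R}^5$ (row vectors) satisfies $E_\theta\{\ell(X_1;\theta)\}=0$ and all entries of $J(\theta)=E_\theta\{\ell(X_1;\theta)^\top\ell(X_1;\theta)\}$ are finite. Let $v_n(t)=\frac1n\sum_{i=1}^n t_1^{X_{i1}}t_2^{X_{i2}}$, let $$V_{n,w}(\hat\theta_n)=\int_0^1\int_0^1 n\{v_n(t)-v(t;\hat\theta_n)\}^2\,w(t)\,dt,$$ and let $\|\varphi\|_{\mathcal H}^2=\int_0^1\int_0^1\varphi^2(t)w(t)\,dt$ be the squared norm of $\mathcal H=L^2([0,1]^2,w)$.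 For $x=(x_1,x_2)\in\mathbb{N}_0^2$ put $$V^0(x;\theta;t)=t_1^{x_1}t_2^{x_2}-v(t;\theta)\left\{1+\left(\lambda,\tfrac12\lambda^2,\eta(t_1-1),\eta(t_2-1),\eta(t_1t_2-1)\right)\ell(x;\theta)^\top\right\}$$ and $W_n(t)=\frac1{\sqrt n}\sum_{i=1}^n V^0(X_i;\theta;t)$. Then $V_{n,w}(\hat\theta_n)$ is finite, $W_n\in\mathcal H$, and $$V_{n,w}(\hat\theta_n)=\|W_n\|_{\mathcal H}^2+o_P(1).$$ Moreover, let $C(\theta)$ be the operator $$C(\theta)\tau(x)=E_\theta\{h(x,Y;\theta)\tau(Y)\},\quad Y\sim BH(\theta),\qquad h(x,y;\theta)=\int_0^1\int_0^1V^0(x;\theta;t)V^0(y;\theta;t)w(t)\,dt,$$ on the space of functions $\tau:\mathbb{N}_0^2\to\mathbb{R}$ with $E_\theta\{\tau^2(Y)\}<\infty$. Its non-null eigenvalues, each repeated according to its multiplicity, can be listed in a finite or infinite sequence $(\kappa_j)_{j\ge1}$ and, for every such sequence, $$V_{n,w}(\hat\theta_n)\ \xrightarrow{\ L\ }\ \sum_{j\ge1}\kappa_j\chi^2_{1j},$$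 where $\chi^2_{11},\chi^2_{12},\ldots$ are independent $\chi^2$ variables with one degree of freedom and the series converges almost surely. -/

import Mathlib

open MeasureTheory ProbabilityTheory Filter Topology

noncomputable section

namespace BivariateHermite

/-- The ambient space `ℝ⁵` of the parameter `θ = (μ, σ², λ₁, λ₂, λ₃)`; the coordinates
`0, 1, 2, 3, 4` are `μ, σ², λ₁, λ₂, λ₃` in this order. -/
abbrev Param : Type := EuclideanSpace ℝ (Fin 5)

/-- The parameter space `Θ`: `μ > σ² (λᵢ + λ₃)` and `λᵢ > λ₃ ≥ 0` for `i = 1, 2`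
(and `σ² ≥ 0`, because `σ²` is a variance). -/
def parameterSpace : Set Param :=
  {θ | 0 ≤ θ 1 ∧ θ 1 * (θ 2 + θ 4) < θ 0 ∧ θ 1 * (θ 3 + θ 4) < θ 0 ∧
    θ 4 < θ 2 ∧ θ 4 < θ 3 ∧ 0 ≤ θ 4}

/-- Bivariate Poisson probability of `(r, s)` with parameters `a, b, c`, where `c` is the parameter
of the common component. As a formula it makes sense for all real `a, b, c`. -/
def bivariatePoissonPMF (a b c : ℝ) (r s : ℕ) : ℝ :=
  Real.exp (-(a + b + c)) *
    ∑ k ∈ Finset.range (min r s + 1),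
      a ^ (r - k) / (r - k).factorial * (b ^ (s - k) / (s - k).factorial) *
        (c ^ k / k.factorial)

/-- `ν` is the bivariate Hermite law `BH(θ)`: the mixture of the bivariate Poisson distributions
with parameters `δ λ₁, δ λ₂, δ λ₃` over `δ ∼ N(μ, σ²)`. -/
def IsBivariateHermite (θ : Param) (ν : Measure (ℕ × ℕ)) : Prop :=
  IsProbabilityMeasure ν ∧
    ∀ r s : ℕ, ν.real {(r, s)} =
      ∫ δ, bivariatePoissonPMF (δ * θ 2) (δ * θ 3) (δ * θ 4) r s
        ∂(gaussianReal (θ 0) (θ 1).toNNReal)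

/-- `λ(t) = λ₁ (t₁ - 1) + λ₂ (t₂ - 1) + λ₃ (t₁ t₂ - 1)`. -/
def lam (θ : Param) (t : ℝ × ℝ) : ℝ :=
  θ 2 * (t.1 - 1) + θ 3 * (t.2 - 1) + θ 4 * (t.1 * t.2 - 1)

/-- The function `v(t; θ) = exp (μ λ + σ² λ² / 2)`. -/
def pgf (θ : Param) (t : ℝ × ℝ) : ℝ :=
  Real.exp (θ 0 * lam θ t + 1 / 2 * θ 1 * lam θ t ^ 2)

/-- `η = μ + σ² λ`. -/
def eta (θ : Param) (t : ℝ × ℝ) : ℝ := θ 0 + θ 1 * lam θ t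

/-- The empirical probability generating function `vₙ(t)` of a sample of size `n`. -/
def epgf {n : ℕ} (x : Fin n → ℕ × ℕ) (t : ℝ × ℝ) : ℝ :=
  1 / (n : ℝ) * ∑ i, t.1 ^ (x i).1 * t.2 ^ (x i).2

/-- `Vₙ(t; θ) = √n (vₙ(t) - v(t; θ))`. -/
def empProcess {n : ℕ} (x : Fin n → ℕ × ℕ) (θ : Param) (t : ℝ × ℝ) : ℝ :=
  √(n : ℝ) * (epgf x t - pgf θ t)

/-- The square `[0,1]²`. -/
def unitSquare : Set (ℝ × ℝ) := Set.Icc 0 1 ×ˢ Set.Icc 0 1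

/-- `f` belongs to the weighted space `ℋ = L²([0,1]², w)`. -/
def MemH (w f : ℝ × ℝ → ℝ) : Prop :=
  AEStronglyMeasurable f (volume.restrict unitSquare) ∧
    IntegrableOn (fun t => f t ^ 2 * w t) unitSquare

/-- The squared norm `‖f‖²` of `ℋ = L²([0,1]², w)`. -/
def normSqH (w f : ℝ × ℝ → ℝ) : ℝ := ∫ t in unitSquare, f t ^ 2 * w t

/-- The statistic `V_{n,w}(θ) = ∫∫ Vₙ(t; θ)² w(t) dt` computed from the sample `x`. -/
def cvmStatistic (w : ℝ × ℝ → ℝ) {n : ℕ} (x : Fin n → ℕ × ℕ) (θ : Param) : ℝ :=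
  ∫ t in unitSquare, empProcess x θ t ^ 2 * w t

/-- `(λ, λ² / 2, η (t₁ - 1), η (t₂ - 1), η (t₁ t₂ - 1))`. -/
def gradVec (θ : Param) (t : ℝ × ℝ) : Fin 5 → ℝ :=
  ![lam θ t, 1 / 2 * lam θ t ^ 2, eta θ t * (t.1 - 1), eta θ t * (t.2 - 1),
    eta θ t * (t.1 * t.2 - 1)]

/-- `V⁰(x, θ; t)`, for the influence function `ℓ`. -/
def V0 (ℓ : ℕ × ℕ → parameterSpace → Param) (θ : parameterSpace) (x : ℕ × ℕ) (t : ℝ × ℝ) : ℝ :=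
  t.1 ^ x.1 * t.2 ^ x.2 - pgf θ t * (1 + ∑ k, gradVec θ t k * ℓ x θ k)

/-- `Wₙ(t) = n^{-1/2} ∑ᵢ V⁰(Xᵢ, θ; t)`. -/
def W (ℓ : ℕ × ℕ → parameterSpace → Param) (θ : parameterSpace) {n : ℕ} (x : Fin n → ℕ × ℕ)
    (t : ℝ × ℝ) : ℝ :=
  1 / √(n : ℝ) * ∑ i, V0 ℓ θ (x i) t

/-- The kernel `h(x, y; θ) = ∫∫ V⁰(x; θ; t) V⁰(y; θ; t) w(t) dt`. -/
def kernelH (w : ℝ × ℝ → ℝ) (ℓ : ℕ × ℕ → parameterSpace → Param) (θ : parameterSpace)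
    (x y : ℕ × ℕ) : ℝ :=
  ∫ t in unitSquare, V0 ℓ θ x t * V0 ℓ θ y t * w t

/-- The first `n` observations `X₁, …, Xₙ`. -/
def sample {Ω : Type*} (X : ℕ → Ω → ℕ × ℕ) (n : ℕ) (ω : Ω) : Fin n → ℕ × ℕ := fun i => X i ω

/-- The asymptotic linear representation of the estimator `θ̂ₙ = θ̂ₙ(X₁, …, Xₙ)` at the true
parameter `θ` (with `ν = BH(θ)` the common law of the observations):
`√n (θ̂ₙ - θ) = n^{-1/2} ∑ᵢ ℓ(Xᵢ; θ) + o_P(1)`, with `E_θ ℓ = 0` and all the entries of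
`J(θ) = E_θ (ℓᵀ ℓ)` finite. -/
structure AsymptoticallyLinear {Ω : Type*} [MeasurableSpace Ω] (P : Measure Ω)
    (X : ℕ → Ω → ℕ × ℕ) (ν : Measure (ℕ × ℕ)) (θhat : (n : ℕ) → (Fin n → ℕ × ℕ) → Param)
    (ℓ : ℕ × ℕ → parameterSpace → Param) (θ : parameterSpace) : Prop where
  expansion : TendstoInMeasure P
    (fun (n : ℕ) ω => √(n : ℝ) • (θhat n (sample X n ω) - (θ : Param)) -
      (1 / √(n : ℝ)) • ∑ i, ℓ (sample X n ω i) θ) atTop (fun _ => 0)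
  mean_zero : ∫ x, ℓ x θ ∂ν = 0
  secondMoment_finite : ∀ a b : Fin 5, Integrable (fun x => ℓ x θ a * ℓ x θ b) ν

/-- The eigenspace, for the number `c`, of the integral operator
`(C τ)(x) = E_ν {k(x, Y) τ(Y)}` on the space of the functions `τ : ℕ² → ℝ` with
`E_ν τ² < ∞`. -/
def eigenspace (ν : Measure (ℕ × ℕ)) (k : ℕ × ℕ → ℕ × ℕ → ℝ) (c : ℝ) :
    Submodule ℝ (ℕ × ℕ → ℝ) where
  carrier := {τ | MemLp τ 2 ν ∧
    ∀ x, Integrable (fun y => k x y * τ y) ν ∧ ∫ y, k x y * τ y ∂ν = c * τ x}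
  add_mem' := by
    rintro f g ⟨hf, hf'⟩ ⟨hg, hg'⟩
    refine ⟨hf.add hg, fun x => ?_⟩
    have e : (fun y => k x y * (f + g) y) = fun y => k x y * f y + k x y * g y := by
      funext y; simp [mul_add]
    rw [e]
    refine ⟨(hf' x).1.add (hg' x).1, ?_⟩
    rw [integral_add (hf' x).1 (hg' x).1, (hf' x).2, (hg' x).2]
    simp [mul_add]
  zero_mem' := by
    refine ⟨MemLp.zero, fun x => ?_⟩
    simp
  smul_mem' := by
    rintro a f ⟨hf, hf'⟩
    refine ⟨hf.const_smul a, fun x => ?_⟩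
    have e : (fun y => k x y * (a • f) y) = fun y => a * (k x y * f y) := by
      funext y; simp only [Pi.smul_apply, smul_eq_mul]; ring
    rw [e]
    refine ⟨(hf' x).1.const_mul a, ?_⟩
    rw [integral_const_mul, (hf' x).2]
    simp only [Pi.smul_apply, smul_eq_mul]; ring

/-- The sequence `e` lists the non-null eigenvalues of the operator with kernel `k`, each one as
often as the dimension of its eigenspace. Entries `0` are allowed as padding, in
particular when there are only finitely many non-null eigenvalues. -/
def EnumeratesNonzeroEigenvalues (ν : Measure (ℕ × ℕ)) (k : ℕ × ℕ → ℕ × ℕ → ℝ)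
    (e : ℕ → ℝ) : Prop :=
  ∀ c : ℝ, c ≠ 0 → {j | e j = c}.encard = Cardinal.toENat (Module.rank ℝ (eigenspace ν k c))

/-- The chi-square law with one degree of freedom: the law of the square of a standard normal
variable. -/
def chiSquareOne : Measure ℝ := (gaussianReal 0 1).map (fun x => x ^ 2)

end BivariateHermite

end

/-! Everything takes place in the Hilbert space `L²(m)`, where `m` is the measure `w(t) dt` on the
unit square. There `V⁰(x; θ; ·)` is a vector `V x`, the statistic is the squared norm of the
empirical process at the estimator, and `h` is the Gram kernel of `V`.

Expansion. The function `v(t; ·)` has a first-order Taylor formula with quadratic remainder, uniform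
in `t` (`exists_abs_pgf_sub_le`). By `empProcess_sub_W` the empirical process differs from `Wₙ` by
`√n` times this remainder and by the gradient applied to the `o_P(1)` term of the estimator. Since
`√n (θ̂ₙ - θ)` is bounded in probability, the difference tends to `0` in norm, and so does the
difference of the squared norms, because `‖Wₙ‖²` is bounded in mean
(`tendstoInMeasure_norm_sq_sub`).

Limit law. `Wₙ` is a normalized sum of iid vectors, centred because `v` is the generating function
of the law (`integral_pow_mul_pow`) and `ℓ` has mean zero. In an eigenbasis of the covariance
operator `T = E (V ⊗ V)` its coordinates are uncorrelated, with the eigenvalues as variances. The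
ordinary central limit theorem handles the first `J` squared coordinates. The mean of the rest is at
most the tail of the trace `∑ e j = E ‖V‖²` for all `n`, so characteristic functions pass to the
limit (`tendstoInDistribution_norm_sq_normalizedSum`).

Eigenvalues. The map `τ ↦ E τ(Y) V(Y)` identifies the eigenspaces of `C(θ)` and of `T` for each
non-null eigenvalue (`eigenspaceEquiv`), so the spectral theory of the compact symmetric operator
`T` transfers to `C(θ)`. -/

noncomputable section

namespace BivariateHermite

/-! ### Spectral theory of the covariance operator, and its duality with the Gram kernel. -/

section CovarianceOperator

variable {H : Type*} [NormedAddCommGroup H] [InnerProductSpace ℝ H] [CompleteSpace H]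
  {ν : Measure (ℕ × ℕ)} {V : ℕ × ℕ → H}

/-- The uncentred covariance operator `E_ν (V ⊗ V)` of the random element `V` of `H`. -/
def covOp (ν : Measure (ℕ × ℕ)) (V : ℕ × ℕ → H) : H →L[ℝ] H :=
  ∫ x, InnerProductSpace.rankOne ℝ (V x) (V x) ∂ν

omit [CompleteSpace H] in
lemma integrable_rankOne (hV : MemLp V 2 ν) :
    Integrable (fun x => InnerProductSpace.rankOne ℝ (V x) (V x)) ν := by
  refine (hV.integrable_norm_pow (p := 2) (by norm_num)).mono' .of_discrete (ae_of_all _ fun x => ?_)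
  simp [sq]

omit [CompleteSpace H] in
lemma integrable_inner_sq (hV : MemLp V 2 ν) (u v : H) :
    Integrable (fun x => inner ℝ (V x) u * inner ℝ (V x) v) ν := by
  refine ((hV.integrable_norm_pow (p := 2) (by norm_num)).mul_const (‖u‖ * ‖v‖)).mono'
    .of_discrete (ae_of_all _ fun x => ?_)
  rw [norm_mul]
  calc _ ≤ (‖V x‖ * ‖u‖) * (‖V x‖ * ‖v‖) := by
        gcongr <;> exact norm_inner_le_norm _ _
    _ = _ := by ring

omit [CompleteSpace H] in
lemma covOp_apply (hV : MemLp V 2 ν) (u : H) :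
    covOp ν V u = ∫ x, inner ℝ (V x) u • V x ∂ν := by
  simp [covOp, ContinuousLinearMap.integral_apply (integrable_rankOne hV)]

lemma inner_covOp (hV : MemLp V 2 ν) (u v : H) :
    inner ℝ u (covOp ν V v) = ∫ x, inner ℝ (V x) u * inner ℝ (V x) v ∂ν := by
  rw [covOp_apply hV, ← integral_inner]
  · simp_rw [inner_smul_right, real_inner_comm u]
    exact integral_congr_ae (ae_of_all _ fun x => mul_comm _ _)
  · simpa using (integrable_rankOne hV).apply_continuousLinearMap v

lemma isSymmetric_covOp (hV : MemLp V 2 ν) : (covOp ν V).IsSymmetric := by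
  intro u v
  simp only [ContinuousLinearMap.coe_coe]
  rw [inner_covOp hV, real_inner_comm, inner_covOp hV]
  exact integral_congr_ae (ae_of_all _ fun x => mul_comm _ _)

/-- The compact operators form a closed convex set, so the mean of the rank-one operators `V x ⊗ V
x`, each factoring through `ℝ`, stays in it. -/
lemma isCompactOperator_covOp [IsProbabilityMeasure ν] (hV : MemLp V 2 ν) :
    IsCompactOperator (covOp ν V) := by
  have h := Convex.integral_mem (s := (compactOperator (RingHom.id ℝ) H H : Set (H →L[ℝ] H)))
    (Submodule.convex _) isClosed_setOfPred_isCompactOperator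
    (ae_of_all ν fun x => ?_) (integrable_rankOne hV)
  · exact h
  · change IsCompactOperator (InnerProductSpace.rankOne ℝ (V x) (V x))
    rw [InnerProductSpace.rankOne_def']
    exact (isCompactOperator_of_locallyCompactSpace_rng
      (ContinuousLinearMap.toSpanSingleton ℝ (V x))).comp_clm (innerSL ℝ (V x))

omit [CompleteSpace H] in
lemma integrable_smul_of_memLp {τ : ℕ × ℕ → ℝ} (hV : MemLp V 2 ν) (hτ : MemLp τ 2 ν) :
    Integrable (fun y => τ y • V y) ν :=
  memLp_one_iff_integrable.1 (hV.smul hτ)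

omit [CompleteSpace H] in
lemma memLp_inner (hV : MemLp V 2 ν) (u : H) : MemLp (fun x => inner ℝ (V x) u) 2 ν :=
  hV.inner_const u

lemma integral_inner_mul {τ : ℕ × ℕ → ℝ} (hV : MemLp V 2 ν) (hτ : MemLp τ 2 ν) (u : H) :
    Integrable (fun y => inner ℝ u (V y) * τ y) ν ∧
      ∫ y, inner ℝ u (V y) * τ y ∂ν = inner ℝ u (∫ y, τ y • V y ∂ν) := by
  have h := integrable_smul_of_memLp hV hτ
  have e : (fun y => inner ℝ u (V y) * τ y) = fun y => inner ℝ u (τ y • V y) := by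
    funext y; rw [inner_smul_right, mul_comm]
  rw [e]
  exact ⟨h.const_inner u, integral_inner h u⟩

/-- The duality between the eigenfunctions of the integral operator with the Gram kernel of `V` and
the eigenvectors of the covariance operator of `V`. -/
def eigenspaceEquiv (hV : MemLp V 2 ν) {c : ℝ} (hc : c ≠ 0) :
    eigenspace ν (fun x y => inner ℝ (V x) (V y)) c ≃ₗ[ℝ]
      Module.End.eigenspace (covOp ν V : H →ₗ[ℝ] H) c where
  toFun τ := ⟨∫ y, (τ : ℕ × ℕ → ℝ) y • V y ∂ν, by
    obtain ⟨τ, h2, h⟩ := τ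
    rw [Module.End.mem_eigenspace_iff]
    simp only [ContinuousLinearMap.coe_coe]
    rw [covOp_apply hV, ← integral_smul]
    congr 1; funext x
    rw [← (integral_inner_mul hV h2 (V x)).2, (h x).2, smul_smul]⟩
  map_add' := by
    rintro ⟨τ, hτ, -⟩ ⟨σ, hσ, -⟩
    ext1
    simp only [Submodule.coe_add, Pi.add_apply, add_smul]
    exact integral_add (integrable_smul_of_memLp hV hτ) (integrable_smul_of_memLp hV hσ)
  map_smul' := by
    rintro a ⟨τ, hτ, -⟩
    ext1
    simp [mul_smul, integral_smul]
  invFun u := ⟨fun x => c⁻¹ * inner ℝ (V x) (u : H), by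
    obtain ⟨u, hu⟩ := u
    rw [Module.End.mem_eigenspace_iff] at hu
    simp only [ContinuousLinearMap.coe_coe] at hu
    have h2 : MemLp (fun x => c⁻¹ * inner ℝ (V x) u) 2 ν := (memLp_inner hV u).const_mul _
    refine ⟨h2, fun x => ⟨(integral_inner_mul hV h2 (V x)).1, ?_⟩⟩
    rw [(integral_inner_mul hV h2 (V x)).2]
    simp_rw [mul_smul]
    rw [integral_smul, ← covOp_apply hV, hu, smul_smul, inv_mul_cancel₀ hc, one_smul,
      mul_inv_cancel_left₀ hc]⟩
  -- The eigenvalue equation holds at every point, so `τ` is recovered everywhere, even at points of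
  -- mass zero. Counting functions instead of almost-everywhere classes therefore does not change
  -- the multiplicity.
  left_inv := by
    rintro ⟨τ, h2, h⟩
    ext x
    simp only
    rw [← (integral_inner_mul hV h2 (V x)).2, (h x).2, inv_mul_cancel_left₀ hc]
  right_inv := by
    rintro ⟨u, hu⟩
    rw [Module.End.mem_eigenspace_iff] at hu
    simp only [ContinuousLinearMap.coe_coe] at hu
    ext1
    simp_rw [mul_smul]
    rw [integral_smul, ← covOp_apply hV, hu, smul_smul, inv_mul_cancel₀ hc, one_smul]

lemma toENat_rank_eigenspace [IsProbabilityMeasure ν] (hV : MemLp V 2 ν) {c : ℝ} (hc : c ≠ 0) :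
    Cardinal.toENat (Module.rank ℝ (eigenspace ν (fun x y => inner ℝ (V x) (V y)) c)) =
      Module.finrank ℝ (Module.End.eigenspace (covOp ν V : H →ₗ[ℝ] H) c) := by
  have := ContinuousLinearMap.finite_dimensional_eigenspace (isCompactOperator_covOp hV) c hc
  have : Module.Finite ℝ (eigenspace ν (fun x y => inner ℝ (V x) (V y)) c) :=
    Module.Finite.equiv (eigenspaceEquiv hV hc).symm
  rw [← Module.finrank_eq_rank, Cardinal.toENat_nat, (eigenspaceEquiv hV hc).finrank_eq]

omit [CompleteSpace H] in
/-- A choice of orthonormal bases of the eigenspaces for the non-null eigenvalues is an orthonormal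
family. -/
lemma orthonormal_of_eigenspaces {ι : {c : ℝ // c ≠ 0} → Type*} {T : H →ₗ[ℝ] H}
    (hT : T.IsSymmetric) (b : ∀ c : {c : ℝ // c ≠ 0}, ι c → Module.End.eigenspace T c)
    (hb : ∀ c, Orthonormal ℝ (b c)) :
    Orthonormal ℝ (fun d : Σ c : {c : ℝ // c ≠ 0}, ι c => (b d.1 d.2 : H)) := by
  have h : OrthogonalFamily ℝ (fun c : {c : ℝ // c ≠ 0} => Module.End.eigenspace T (c : ℝ))
      fun c => (Module.End.eigenspace T (c : ℝ)).subtypeₗᵢ :=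
    hT.orthogonalFamily_eigenspaces.comp Subtype.coe_injective
  exact h.orthonormal_sigma_orthonormal hb

/-- A countable multiset of non-zero reals can be listed in a sequence, with zeros as padding. -/
lemma exists_seq_encard_fiber {d : ℝ → ℕ} (hd : Countable (Σ c : {c : ℝ // c ≠ 0}, Fin (d c))) :
    ∃ e : ℕ → ℝ, ∀ c, c ≠ 0 → {j | e j = c}.encard = d c := by
  obtain ⟨f, hf⟩ := exists_injective_nat (Σ c : {c : ℝ // c ≠ 0}, Fin (d c))
  refine ⟨Function.extend f (fun d => (d.1 : ℝ)) 0, fun c hc => ?_⟩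
  have : {j | Function.extend f (fun d => (d.1 : ℝ)) 0 j = c} =
      Set.range fun i : Fin (d c) => f ⟨⟨c, hc⟩, i⟩ := by
    ext j
    simp only [Set.mem_ofPred_eq, Set.mem_range]
    constructor
    · intro hj
      by_cases h : ∃ d, f d = j
      · obtain ⟨⟨⟨c', hc'⟩, i⟩, rfl⟩ := h
        rw [hf.extend_apply] at hj
        obtain rfl : c' = c := hj
        exact ⟨i, rfl⟩
      · rw [Function.extend_apply' _ _ _ h] at hj
        exact absurd hj.symm hc
    · rintro ⟨i, rfl⟩
      rw [hf.extend_apply]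
  rw [this, ← Set.image_univ, Function.Injective.encard_image]
  · simp
  · intro i j hij
    simpa using hf hij

/-- Countability of the spectrum needs no separability of `H`: an eigenvector for a non-null
eigenvalue is not orthogonal to all of the countably many vectors `V x`, and by Bessel each `V x`
has non-zero product with only countably many members of an orthonormal family. -/
lemma exists_enumeration [IsProbabilityMeasure ν] (hV : MemLp V 2 ν) :
    ∃ e : ℕ → ℝ, EnumeratesNonzeroEigenvalues ν (fun x y => inner ℝ (V x) (V y)) e := by
  classical
  set T : H →ₗ[ℝ] H := (covOp ν V : H →ₗ[ℝ] H) with hTdef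
  have hT : T.IsSymmetric := isSymmetric_covOp hV
  have hfin (c : {c : ℝ // c ≠ 0}) : FiniteDimensional ℝ (Module.End.eigenspace T (c : ℝ)) :=
    ContinuousLinearMap.finite_dimensional_eigenspace (isCompactOperator_covOp hV) c.1 c.2
  let b (c : {c : ℝ // c ≠ 0}) := stdOrthonormalBasis ℝ (Module.End.eigenspace T (c : ℝ))
  have hb := orthonormal_of_eigenspaces hT (fun c => b c) fun c => (b c).orthonormal
  let D := Σ c : {c : ℝ // c ≠ 0}, Fin (Module.finrank ℝ (Module.End.eigenspace T (c : ℝ)))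
  have hD : Countable D := by
    rw [← Set.countable_univ_iff]
    refine (Set.countable_iUnion fun x : ℕ × ℕ =>
      (hb.inner_products_summable (V x)).countable_support).mono fun d _ => ?_
    by_contra hd
    simp only [Set.mem_iUnion, Function.mem_support, not_exists, not_not] at hd
    have hz : T (b d.1 d.2 : H) = 0 := by
      change covOp ν V _ = 0
      rw [covOp_apply hV]
      have (x : ℕ × ℕ) : inner ℝ (V x) (b d.1 d.2 : H) = 0 := by
        rw [real_inner_comm]; simpa using hd x
      simp [this]
    have he := Module.End.mem_eigenspace_iff.1 (b d.1 d.2).2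
    rw [hz, eq_comm, smul_eq_zero] at he
    exact he.elim d.1.2 (hb.ne_zero d)
  obtain ⟨e, he⟩ := exists_seq_encard_fiber
    (d := fun c => Module.finrank ℝ (Module.End.eigenspace T c)) hD
  exact ⟨e, fun c hc => by rw [toENat_rank_eigenspace hV hc, he c hc]⟩

/-- Orthonormal eigenvectors `ψ j` for the listed eigenvalues `e j ≠ 0`, and `ψ j = 0` for the
padding entries. -/
structure IsEigenSystem (T : H →L[ℝ] H) (e : ℕ → ℝ) (ψ : ℕ → H) : Prop where
  eq_zero : ∀ j, e j = 0 → ψ j = 0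
  orthonormal : Orthonormal ℝ fun j : {j // e j ≠ 0} => ψ j
  apply_eq : ∀ j, T (ψ j) = e j • ψ j
  ker : ∀ u, (∀ j, inner ℝ (ψ j) u = 0) → T u = 0

/-- For `c ≠ 0` the set of indices `j` with `e j = c` has as many elements as the eigenspace has
dimensions, so it can index an orthonormal basis of that eigenspace; the bases together give `ψ`. -/
lemma exists_isEigenSystem [IsProbabilityMeasure ν] (hV : MemLp V 2 ν) {e : ℕ → ℝ}
    (he : EnumeratesNonzeroEigenvalues ν (fun x y => inner ℝ (V x) (V y)) e) :
    ∃ ψ, IsEigenSystem (covOp ν V) e ψ := by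
  classical
  set T : H →ₗ[ℝ] H := (covOp ν V : H →ₗ[ℝ] H) with hTdef
  have hT : T.IsSymmetric := isSymmetric_covOp hV
  have hfin (c : {c : ℝ // c ≠ 0}) : FiniteDimensional ℝ (Module.End.eigenspace T (c : ℝ)) :=
    ContinuousLinearMap.finite_dimensional_eigenspace (isCompactOperator_covOp hV) c.1 c.2
  have hcard (c : {c : ℝ // c ≠ 0}) : Nonempty
      (Fin (Module.finrank ℝ (Module.End.eigenspace T (c : ℝ))) ≃ {j // e j = c}) := by
    have h := he c c.2
    rw [toENat_rank_eigenspace hV c.2] at h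
    have hf : {j | e j = c}.Finite := Set.finite_of_encard_eq_coe h
    have := hf.fintype
    rw [Set.encard_eq_coe_toFinset_card, Nat.cast_inj, Set.toFinset_card] at h
    exact ⟨(Fintype.equivFinOfCardEq h).symm⟩
  have hft (c : {c : ℝ // c ≠ 0}) : Fintype {j // e j = c} := Fintype.ofEquiv _ (hcard c).some
  obtain ⟨b⟩ : Nonempty (∀ c : {c : ℝ // c ≠ 0},
      OrthonormalBasis {j // e j = c} ℝ (Module.End.eigenspace T (c : ℝ))) :=
    ⟨fun c => (stdOrthonormalBasis ℝ (Module.End.eigenspace T (c : ℝ))).reindex (hcard c).some⟩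
  have hb := orthonormal_of_eigenspaces hT (fun c => b c) fun c => (b c).orthonormal
  let ψ (j : ℕ) : H := if h : e j ≠ 0 then (b ⟨e j, h⟩ ⟨j, rfl⟩ : H) else 0
  have hψ (c : {c : ℝ // c ≠ 0}) (i : {j // e j = c}) : ψ i = b c i := by
    obtain ⟨c, hc⟩ := c
    obtain ⟨j, hj⟩ := i
    dsimp only at hj
    subst hj
    exact dif_pos hc
  have hψ' (j : {j // e j ≠ 0}) : ψ j = b ⟨e j, j.2⟩ ⟨j, rfl⟩ := dif_pos j.2
  refine ⟨ψ, fun j hj => dif_neg (not_not.2 hj), ?_, fun j => ?_, fun u hu => ?_⟩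
  · simp_rw [hψ']
    refine hb.comp (fun j : {j // e j ≠ 0} => ⟨⟨e j, j.2⟩, ⟨j, rfl⟩⟩) fun i j hij => ?_
    have h1 : ψ i = ψ j := by
      rw [hψ', hψ']
      exact congrArg (fun d : Σ c : {c : ℝ // c ≠ 0}, {j // e j = c} => (b d.1 d.2 : H)) hij
    have h2 := congrArg (fun d : Σ c : {c : ℝ // c ≠ 0}, {j // e j = c} => (d.2 : ℕ)) hij
    exact Subtype.ext h2
  · by_cases hj : e j = 0
    · simp [ψ, hj]
    · rw [hψ' ⟨j, hj⟩]
      exact Module.End.mem_eigenspace_iff.1 (b ⟨e j, hj⟩ ⟨j, rfl⟩).2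
  -- If `u` is orthogonal to all `ψ j`, then `T u` is orthogonal to every eigenspace, the kernel
  -- included by symmetry; the spectral theorem then forces `T u = 0`.
  · have key (c : ℝ) (w : Module.End.eigenspace T c) : inner ℝ (w : H) (T u) = 0 := by
      rw [← hT, Module.End.mem_eigenspace_iff.1 w.2, real_inner_smul_left]
      by_cases hc : c = 0
      · simp [hc]
      rw [← (b ⟨c, hc⟩).sum_repr' w, Submodule.coe_sum, sum_inner, Finset.sum_eq_zero, mul_zero]
      intro i _
      rw [Submodule.coe_smul, real_inner_smul_left, ← hψ ⟨c, hc⟩ i, hu, mul_zero]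
    have hmem : T u ∈ (⨆ c, Module.End.eigenspace T c)ᗮ := by
      rw [← Submodule.iInf_orthogonal, Submodule.mem_iInf]
      exact fun c => (Submodule.mem_orthogonal _ _).2 fun w hw => key c ⟨w, hw⟩
    rw [ContinuousLinearMap.orthogonalComplement_iSup_eigenspaces_eq_bot
      (isCompactOperator_covOp hV) (isSymmetric_covOp hV)] at hmem
    exact hmem

/-- Parseval's identity for the eigenvectors of `T`, on the orthogonal complement of its kernel. -/
lemma IsEigenSystem.hasSum_inner_sq {T : H →L[ℝ] H} {e : ℕ → ℝ} {ψ : ℕ → H}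
    (h : IsEigenSystem T e ψ) {y : H} (hy : ∀ u, T u = 0 → inner ℝ u y = 0) :
    HasSum (fun j => inner ℝ (ψ j) y ^ 2) (‖y‖ ^ 2) := by
  -- Parseval in a Hilbert basis containing the non-zero `ψ j`. The added basis vectors are
  -- orthogonal to all `ψ j`, hence lie in the kernel of `T` and contribute nothing.
  obtain ⟨w, b, hw, hb⟩ := h.orthonormal.toSubtypeRange.exists_hilbertBasis_extension
  have h1 := b.hasSum_inner_mul_inner y y
  simp_rw [real_inner_comm (b _) y, ← sq, real_inner_self_eq_norm_sq, hb] at h1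
  let g (j : {j // e j ≠ 0}) : w := ⟨ψ j, hw ⟨j, rfl⟩⟩
  have hg : Function.Injective g := fun i j hij =>
    h.orthonormal.linearIndependent.injective (congrArg Subtype.val hij)
  rw [← hg.hasSum_iff] at h1
  · rw [← (Subtype.val_injective (p := fun j => e j ≠ 0)).hasSum_iff]
    · exact h1
    · intro j hj
      rw [h.eq_zero j (by simpa using hj)]
      simp
  · intro i hi
    have hi0 : inner ℝ (i : H) y = 0 := by
      refine hy _ (h.ker _ fun j => ?_)
      by_cases hj : e j = 0
      · rw [h.eq_zero j hj, inner_zero_left]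
      · have := b.orthonormal.inner_eq_zero (i := g ⟨j, hj⟩) (j := i) fun hij => hi ⟨_, hij⟩
        rwa [hb] at this
    rw [hi0]; simp

section

variable {e : ℕ → ℝ} {ψ : ℕ → H}

lemma IsEigenSystem.integral_inner_mul_inner (hV : MemLp V 2 ν)
    (h : IsEigenSystem (covOp ν V) e ψ) (i j : ℕ) :
    ∫ x, inner ℝ (ψ i) (V x) * inner ℝ (ψ j) (V x) ∂ν = if i = j then e j else 0 := by
  simp_rw [real_inner_comm (V _)]
  rw [← inner_covOp hV, h.apply_eq, real_inner_smul_right]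
  by_cases hj : e j = 0
  · simp [hj]
  by_cases hi : e i = 0
  · rw [h.eq_zero i hi, inner_zero_left, mul_zero, if_neg]
    rintro rfl
    exact hj hi
  have := orthonormal_iff_ite.1 h.orthonormal ⟨i, hi⟩ ⟨j, hj⟩
  simp only [Subtype.mk.injEq] at this
  rw [this]
  simp

lemma IsEigenSystem.nonneg (hV : MemLp V 2 ν) (h : IsEigenSystem (covOp ν V) e ψ) (j : ℕ) :
    0 ≤ e j := by
  have := h.integral_inner_mul_inner hV j j
  rw [if_pos rfl] at this
  rw [← this]
  exact integral_nonneg fun x => mul_self_nonneg _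

/-- If `T u = 0` then `E ⟨V, u⟩² = ⟨u, T u⟩ = 0`. On a countable space the exceptional set is the
set of points of mass zero, which does not depend on `u`. -/
lemma ae_inner_eq_zero (hV : MemLp V 2 ν) :
    ∀ᵐ x ∂ν, ∀ u, covOp ν V u = 0 → inner ℝ u (V x) = 0 := by
  rw [ae_iff_of_countable]
  intro x hx u hu
  have h := inner_covOp hV u u
  rw [hu, inner_zero_right, eq_comm,
    integral_eq_zero_iff_of_nonneg (fun x => mul_self_nonneg _) (integrable_inner_sq hV u u)] at h
  have := ae_iff_of_countable.1 h x hx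
  rw [real_inner_comm]
  simpa using this

/-- The trace formula for the covariance operator. -/
lemma IsEigenSystem.hasSum_eigenvalues (hV : MemLp V 2 ν) (h : IsEigenSystem (covOp ν V) e ψ) :
    HasSum e (∫ x, ‖V x‖ ^ 2 ∂ν) := by
  have hpar : ∀ᵐ x ∂ν, HasSum (fun j => inner ℝ (ψ j) (V x) ^ 2) (‖V x‖ ^ 2) := by
    filter_upwards [ae_inner_eq_zero hV] with x hx using h.hasSum_inner_sq hx
  -- The terms are nonnegative and dominate themselves; Parseval gives their sum `‖V x‖²`, which is
  -- integrable.
  have := hasSum_integral_of_dominated_convergence (μ := ν)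
    (F := fun j x => inner ℝ (ψ j) (V x) ^ 2) (f := fun x => ‖V x‖ ^ 2)
    (fun j x => inner ℝ (ψ j) (V x) ^ 2) (fun _ => .of_discrete)
    (fun j => ae_of_all _ fun x => by simp) (hpar.mono fun x hx => hx.summable)
    ((hV.integrable_norm_pow (p := 2) (by norm_num)).congr
      (hpar.mono fun x hx => hx.tsum_eq.symm)) hpar
  have he : (fun j => ∫ x, inner ℝ (ψ j) (V x) ^ 2 ∂ν) = e := by
    funext j
    have := h.integral_inner_mul_inner hV j j
    rw [if_pos rfl] at this
    simp_rw [sq]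
    exact this
  rwa [he] at this

end

end CovarianceOperator

/-! ### Convergence in law by approximation, and a criterion for convergence in probability. -/

section Convergence

variable {Ω Ω' : Type*} [MeasurableSpace Ω] [MeasurableSpace Ω'] {P : Measure Ω}
  [IsProbabilityMeasure P] {P' : Measure Ω'} [IsProbabilityMeasure P']

lemma norm_cexp_mul_I_sub_le (a b : ℝ) :
    ‖Complex.exp (a * Complex.I) - Complex.exp (b * Complex.I)‖ ≤ |a - b| := by
  have h : Complex.exp (a * Complex.I) - Complex.exp (b * Complex.I) =
      Complex.exp (b * Complex.I) * (Complex.exp (Complex.I * (a - b : ℝ)) - 1) := by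
    rw [mul_sub, ← Complex.exp_add]
    congr 2
    · push_cast; ring
    · ring
  rw [h, norm_mul, Complex.norm_exp_ofReal_mul_I, one_mul]
  exact Real.norm_exp_I_mul_ofReal_sub_one_le

omit [IsProbabilityMeasure P] in
lemma charFun_map_real {X : Ω → ℝ} (hX : AEMeasurable X P) (t : ℝ) :
    charFun (P.map X) t = ∫ ω, Complex.exp ((t * X ω : ℝ) * Complex.I) ∂P := by
  rw [charFun_apply_real, integral_map hX (by fun_prop)]
  simp

lemma integrable_cexp_mul_I {X : Ω → ℝ} (hX : AEMeasurable X P) :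
    Integrable (fun ω => Complex.exp ((X ω : ℝ) * Complex.I)) P := by
  refine Integrable.of_bound (by fun_prop) 1 (ae_of_all _ fun ω => ?_)
  rw [Complex.norm_exp_ofReal_mul_I]

lemma norm_charFun_map_sub_le {X Y : Ω → ℝ} (hX : AEMeasurable X P) (hY : AEMeasurable Y P)
    (hXY : Integrable (fun ω => X ω - Y ω) P) (t : ℝ) :
    ‖charFun (P.map X) t - charFun (P.map Y) t‖ ≤ |t| * ∫ ω, |X ω - Y ω| ∂P := by
  rw [charFun_map_real hX, charFun_map_real hY, ← integral_sub
    (integrable_cexp_mul_I (hX.const_mul t)) (integrable_cexp_mul_I (hY.const_mul t)),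
    ← integral_const_mul]
  refine norm_integral_le_of_norm_le (hXY.abs.const_mul |t|) (ae_of_all _ fun ω => ?_)
  refine (norm_cexp_mul_I_sub_le _ _).trans_eq ?_
  rw [← mul_sub, abs_mul]

/-- Convergence in distribution from approximations that are uniformly close in mean. -/
lemma tendstoInDistribution_of_approx {X : ℕ → Ω → ℝ} {Y : ℕ → ℕ → Ω → ℝ} {Z : Ω' → ℝ}
    {T : ℕ → Ω' → ℝ} {ε : ℕ → ℝ} (hX : ∀ n, AEMeasurable (X n) P)
    (hYT : ∀ J, TendstoInDistribution (Y J) atTop (T J) (fun _ => P) P')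
    (hTZ : ∀ᵐ ω ∂P', Tendsto (fun J => T J ω) atTop (𝓝 (Z ω)))
    (hε : Tendsto ε atTop (𝓝 0)) (hint : ∀ J n, Integrable (fun ω => X n ω - Y J n ω) P)
    (hXY : ∀ J n, ∫ ω, |X n ω - Y J n ω| ∂P ≤ ε J) :
    TendstoInDistribution X atTop Z (fun _ => P) P' := by
  have hT J := (hYT J).aemeasurable_limit
  have hZ : AEMeasurable Z P' := aemeasurable_of_tendsto_metrizable_ae atTop hT hTZ
  refine ⟨hX, hZ, ProbabilityMeasure.tendsto_of_tendsto_charFun fun t => ?_⟩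
  have h1 J := ProbabilityMeasure.tendsto_iff_tendsto_charFun.1 (hYT J).tendsto t
  have h2 := ProbabilityMeasure.tendsto_iff_tendsto_charFun.1
    (tendstoInDistribution_of_ae_tendsto hT hZ hTZ).tendsto t
  simp only [ProbabilityMeasure.coe_mk] at h1 h2 ⊢
  have h3 : Tendsto (fun J => |t| * ε J) atTop (𝓝 0) := by simpa using hε.const_mul |t|
  rw [Metric.tendsto_atTop]
  intro δ hδ
  obtain ⟨J, hJ2, hJ3⟩ := ((h2.eventually (Metric.ball_mem_nhds _ (by positivity : 0 < δ / 3))).and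
    (h3.eventually (gt_mem_nhds (by positivity : 0 < δ / 3)))).exists
  obtain ⟨N, hN⟩ := Metric.tendsto_atTop.1 (h1 J) (δ / 3) (by positivity)
  refine ⟨N, fun n hn => ?_⟩
  have ha : dist (charFun (P.map (X n)) t) (charFun (P.map (Y J n)) t) < δ / 3 := by
    rw [dist_eq_norm]
    refine ((norm_charFun_map_sub_le (hX n) ((hYT J).forall_aemeasurable n) (hint J n) t).trans
      ?_).trans_lt hJ3
    gcongr
    exact hXY J n
  have hb := hN n hn
  change dist _ _ < δ / 3 at hJ2
  have := dist_triangle4 (charFun (P.map (X n)) t) (charFun (P.map (Y J n)) t)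
    (charFun (P'.map (T J)) t) (charFun (P'.map Z) t)
  linarith

lemma TendstoInDistribution.of_map_eq {Ω'' : Type*} [MeasurableSpace Ω''] {P'' : Measure Ω''}
    [IsProbabilityMeasure P''] {X : ℕ → Ω → ℝ} {Y : Ω' → ℝ} {Z : Ω'' → ℝ}
    (h : TendstoInDistribution X atTop Y (fun _ => P) P') (hZ : AEMeasurable Z P'')
    (hYZ : P'.map Y = P''.map Z) : TendstoInDistribution X atTop Z (fun _ => P) P'' := by
  refine ⟨h.forall_aemeasurable, hZ, ?_⟩
  have := h.tendsto
  rwa [show (⟨P'.map Y, Measure.isProbabilityMeasure_map h.aemeasurable_limit⟩ :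
    ProbabilityMeasure ℝ) = ⟨P''.map Z, Measure.isProbabilityMeasure_map hZ⟩ from
    Subtype.ext hYZ] at this

/-- A variable which is small when `U` is small and `S` is bounded converges to `0` in probability
if `U` does and `S ≥ 0` is bounded in mean. -/
lemma tendstoInMeasure_zero_of_bounded {D U S : ℕ → Ω → ℝ} {K : ℝ}
    (hU : TendstoInMeasure P U atTop (fun _ => 0)) (hS0 : ∀ n ω, 0 ≤ S n ω)
    (hS : ∀ n, Integrable (S n) P) (hSK : ∀ n, ∫ ω, S n ω ∂P ≤ K)
    (h : ∀ M ε : ℝ, 0 < M → 0 < ε → ∃ δ > 0, ∃ N, ∀ n ≥ N, ∀ ω, |U n ω| < δ → S n ω < M →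
      |D n ω| < ε) :
    TendstoInMeasure P D atTop (fun _ => 0) := by
  rw [tendstoInMeasure_iff_measureReal_norm] at hU ⊢
  simp only [sub_zero, Real.norm_eq_abs] at hU ⊢
  intro ε hε
  have hK : 0 ≤ K := (integral_nonneg (hS0 0)).trans (hSK 0)
  rw [Metric.tendsto_atTop]
  intro η hη
  set M := 2 * (K + 1) / η with hM
  have hM0 : 0 < M := by positivity
  obtain ⟨δ, hδ, N, hN⟩ := h M ε hM0 hε
  obtain ⟨N', hN'⟩ := Metric.tendsto_atTop.1 (hU δ hδ) (η / 2) (by positivity)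
  refine ⟨max N N', fun n hn => ?_⟩
  have h1 := hN' n (le_of_max_le_right hn)
  rw [Real.dist_eq, sub_zero, abs_of_nonneg measureReal_nonneg] at h1 ⊢
  have h2 : M * P.real {ω | M ≤ S n ω} ≤ K :=
    (mul_meas_ge_le_integral_of_nonneg (ae_of_all _ (hS0 n)) (hS n) M).trans (hSK n)
  have h3 : P.real {ω | ε ≤ |D n ω|} ≤
      P.real {ω | δ ≤ |U n ω|} + P.real {ω | M ≤ S n ω} := by
    refine (measureReal_mono fun ω hω => ?_).trans (measureReal_union_le _ _)
    by_contra hc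
    simp only [Set.mem_union, Set.mem_ofPred_eq, not_or, not_le] at hc hω
    exact (hN n (le_of_max_le_left hn) ω hc.1 hc.2).not_ge hω
  have h4 : P.real {ω | M ≤ S n ω} < η / 2 := by
    have : M * (η / 2) = K + 1 := by rw [hM]; field_simp
    nlinarith
  linarith

end Convergence

/-! ### Second moments and central limit theorems for normalized sums of the sample. -/

section Sample

variable {Ω : Type*} [MeasurableSpace Ω] {P : Measure Ω} [IsProbabilityMeasure P]
  {ν : Measure (ℕ × ℕ)} {X : ℕ → Ω → ℕ × ℕ}
  {H : Type*} [NormedAddCommGroup H] [InnerProductSpace ℝ H] [CompleteSpace H]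

/-- The normalized sum `n^{-1/2} ∑ᵢ f(xᵢ)`. -/
def normalizedSum (f : ℕ × ℕ → H) {n : ℕ} (x : Fin n → ℕ × ℕ) : H :=
  (1 / √(n : ℝ)) • ∑ i, f (x i)

-- The sample takes values in a countable discrete space, so every statistic is measurable; this is
-- why neither the estimator nor `ℓ` carries a measurability assumption.
omit [IsProbabilityMeasure P] in
lemma aemeasurable_comp_sample {E : Type*} [MeasurableSpace E] (hX : ∀ i, HasLaw (X i) ν P) {n : ℕ}
    (F : (Fin n → ℕ × ℕ) → E) : AEMeasurable (fun ω => F (sample X n ω)) P := by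
  have : Measurable F := .of_discrete
  exact this.comp_aemeasurable (aemeasurable_pi_lambda _ fun i => (hX i).aemeasurable)

omit [IsProbabilityMeasure P] [CompleteSpace H] in
lemma integrable_inner_comp_comp (hX : ∀ i, HasLaw (X i) ν P) {f : ℕ × ℕ → H} (hf : MemLp f 2 ν)
    (i j : ℕ) : Integrable (fun ω => (inner ℝ (f (X i ω)) (f (X j ω)) : ℝ)) P := by
  have h (i : ℕ) : MemLp (fun ω => f (X i ω)) 2 P := by
    have := hf
    rw [← (hX i).map_eq] at this
    exact this.comp_of_map (hX i).aemeasurable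
  refine (((h i).integrable_norm_pow (p := 2) (by norm_num)).add
    ((h j).integrable_norm_pow (p := 2) (by norm_num))).mono'
    ((h i).1.inner (h j).1) (ae_of_all _ fun ω => (norm_inner_le_norm _ _).trans ?_)
  simp only [Pi.add_apply]
  nlinarith [sq_nonneg (‖f (X i ω)‖ - ‖f (X j ω)‖), sq_nonneg (‖f (X i ω)‖ + ‖f (X j ω)‖)]

-- In the double sum for the squared norm, independence and centring kill the off-diagonal terms.
omit [IsProbabilityMeasure P] in
lemma integral_norm_sq_normalizedSum [IsProbabilityMeasure ν] (hX : ∀ i, HasLaw (X i) ν P) (hi : iIndepFun X P)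
    {f : ℕ × ℕ → H} (hf : MemLp f 2 ν) (h0 : ∫ x, f x ∂ν = 0) {n : ℕ} (hn : n ≠ 0) :
    Integrable (fun ω => ‖normalizedSum f (sample X n ω)‖ ^ 2) P ∧
      ∫ ω, ‖normalizedSum f (sample X n ω)‖ ^ 2 ∂P = ∫ x, ‖f x‖ ^ 2 ∂ν := by
  have hexp (ω : Ω) : ‖normalizedSum f (sample X n ω)‖ ^ 2 =
      (n : ℝ)⁻¹ * ∑ i : Fin n, ∑ j : Fin n, inner ℝ (f (X i ω)) (f (X j ω)) := by
    rw [normalizedSum, norm_smul, mul_pow, ← real_inner_self_eq_norm_sq (∑ i, _), sum_inner]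
    simp_rw [inner_sum]
    congr 1
    rw [Real.norm_eq_abs, sq_abs, div_pow, Real.sq_sqrt (Nat.cast_nonneg _), one_pow, one_div]
  simp_rw [hexp]
  have hin := integrable_inner_comp_comp hX hf
  have hint (i j : Fin n) : Integrable (fun ω => (inner ℝ (f (X i ω)) (f (X j ω)) : ℝ)) P :=
    hin i j
  refine ⟨(integrable_finsetSum _ fun i _ => integrable_finsetSum _ fun j _ =>
    hint i j).const_mul _, ?_⟩
  have hc (i j : Fin n) : ∫ ω, (inner ℝ (f (X i ω)) (f (X j ω)) : ℝ) ∂P =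
      if i = j then ∫ x, ‖f x‖ ^ 2 ∂ν else 0 := by
    split_ifs with hij
    · subst hij
      simp_rw [real_inner_self_eq_norm_sq]
      exact (hX i).integral_comp (f := fun x => ‖f x‖ ^ 2) .of_discrete
    · have hind : IndepFun (X i) (X j) P := hi.indepFun fun h => hij (Fin.ext h)
      have hfi : Integrable f ν := hf.integrable (by norm_num)
      have := hind.integral_bilin_comp_comp (f := f) (g := f) (hX i).aemeasurable
        (hX j).aemeasurable (by rwa [(hX i).map_eq]) (by rwa [(hX j).map_eq]) (innerSL ℝ)
      change ∫ ω, (inner ℝ (f (X i ω)) (f (X j ω)) : ℝ) ∂P =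
        inner ℝ (∫ ω, f (X i ω) ∂P) (∫ ω, f (X j ω) ∂P) at this
      have hz : ∫ ω, f (X i ω) ∂P = 0 :=
        ((hX i).integral_comp (f := f) .of_discrete).trans h0
      rw [this, hz, inner_zero_left]
  rw [integral_const_mul, integral_finsetSum _ fun i _ => integrable_finsetSum _ fun j _ =>
    hint i j]
  rw [Finset.sum_congr rfl fun i _ => (integral_finsetSum _ fun j _ => hint i j).trans
    (Finset.sum_congr rfl fun j _ => hc i j)]
  simp [hn]

omit [IsProbabilityMeasure P] in
lemma integral_norm_sq_normalizedSum_le [IsProbabilityMeasure ν] (hX : ∀ i, HasLaw (X i) ν P) (hi : iIndepFun X P)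
    {f : ℕ × ℕ → H} (hf : MemLp f 2 ν) (h0 : ∫ x, f x ∂ν = 0) (n : ℕ) :
    Integrable (fun ω => ‖normalizedSum f (sample X n ω)‖ ^ 2) P ∧
      ∫ ω, ‖normalizedSum f (sample X n ω)‖ ^ 2 ∂P ≤ ∫ x, ‖f x‖ ^ 2 ∂ν := by
  rcases eq_or_ne n 0 with rfl | hn
  -- For `n = 0` the empty sum vanishes, so that only the inequality survives.
  · simp only [normalizedSum, Finset.univ_eq_empty, Finset.sum_empty, smul_zero, norm_zero]
    simp
    exact integral_nonneg fun x => by positivity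
  · exact ⟨(integral_norm_sq_normalizedSum hX hi hf h0 hn).1,
      (integral_norm_sq_normalizedSum hX hi hf h0 hn).2.le⟩

omit [CompleteSpace H] in
lemma inner_normalizedSum (f : ℕ × ℕ → H) (u : H) {n : ℕ} (x : Fin n → ℕ × ℕ) :
    inner ℝ u (normalizedSum f x) = normalizedSum (fun y => inner ℝ u (f y)) x := by
  simp [normalizedSum, inner_sum, real_inner_smul_right]

/-- The central limit theorem for a real function of the observations. -/
lemma tendstoInDistribution_normalizedSum (hX : ∀ i, HasLaw (X i) ν P) (hi : iIndepFun X P)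
    {f : ℕ × ℕ → ℝ} (hf : MemLp f 2 ν) (h0 : ∫ x, f x ∂ν = 0) :
    TendstoInDistribution (fun (n : ℕ) ω => normalizedSum f (sample X n ω)) atTop id (fun _ => P)
      (gaussianReal 0 (∫ x, f x ^ 2 ∂ν).toNNReal) := by
  have hm : Measurable f := .of_discrete
  have hlaw (i : ℕ) : HasLaw (fun ω => f (X i ω)) (ν.map f) P :=
    HasLaw.fun_comp ⟨hm.aemeasurable, rfl⟩ (hX i)
  have hmem : MemLp (fun ω => f (X 0 ω)) 2 P := by
    have := hf
    rw [← (hX 0).map_eq] at this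
    exact this.comp_of_map (hX 0).aemeasurable
  have hmean : ∫ ω, f (X 0 ω) ∂P = 0 := by
    exact ((hX 0).integral_comp (f := f) .of_discrete).trans h0
  have hvar : Var[fun ω => f (X 0 ω); P] = ∫ x, f x ^ 2 ∂ν := by
    rw [variance_of_integral_eq_zero hmem.aemeasurable hmean]
    exact (hX 0).integral_comp (f := fun x => f x ^ 2) .of_discrete
  have := tendstoInDistribution_inv_sqrt_mul_sum_sub (X := fun i ω => f (X i ω)) (P := P)
    (P' := gaussianReal 0 (∫ x, f x ^ 2 ∂ν).toNNReal) (Y := id)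
    (by rw [hvar]; exact HasLaw.id) hmem (hi.comp (fun _ => f) fun _ => hm)
    fun i => ⟨(hlaw i).aemeasurable, (hlaw 0).aemeasurable,
      (hlaw i).map_eq.trans (hlaw 0).map_eq.symm⟩
  convert this using 3 with n ω
  rw [hmean, normalizedSum, smul_eq_mul, one_div, mul_zero, sub_zero,
    ← Fin.sum_univ_eq_sum_range (fun k => f (X k ω)) n]
  rfl

lemma normalizedSum_sum_mul {J : ℕ} (f : Fin J → ℕ × ℕ → ℝ) (t : Fin J → ℝ) {n : ℕ}
    (x : Fin n → ℕ × ℕ) :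
    normalizedSum (fun y => ∑ j, t j * f j y) x = ∑ j, t j * normalizedSum (f j) x := by
  simp only [normalizedSum, smul_eq_mul, Finset.mul_sum]
  rw [Finset.sum_comm]
  exact Finset.sum_congr rfl fun j _ => Finset.sum_congr rfl fun i _ => by ring

/-- The multivariate central limit theorem for uncorrelated functions of the observations. -/
lemma tendstoInDistribution_normalizedSum_pi [IsProbabilityMeasure ν] (hX : ∀ i, HasLaw (X i) ν P) (hi : iIndepFun X P)
    {J : ℕ} {f : Fin J → ℕ × ℕ → ℝ} {e : Fin J → ℝ} (hf : ∀ j, MemLp (f j) 2 ν)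
    (h0 : ∀ j, ∫ x, f j x ∂ν = 0) (he : ∀ j, 0 ≤ e j)
    (hcov : ∀ i j, ∫ x, f i x * f j x ∂ν = if i = j then e j else 0) :
    TendstoInDistribution
      (fun (n : ℕ) ω => WithLp.toLp 2 fun j => normalizedSum (f j) (sample X n ω)) atTop
      (WithLp.toLp 2) (fun _ => P) (Measure.pi fun j => gaussianReal 0 (e j).toNNReal) := by
  refine ⟨fun n => aemeasurable_comp_sample hX fun x => WithLp.toLp 2 fun j => normalizedSum (f j) x,
    by fun_prop, ProbabilityMeasure.tendsto_of_tendsto_charFun fun t => ?_⟩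
  simp only [ProbabilityMeasure.coe_mk]
  rw [charFun_pi]
  have hg2 : MemLp (fun x => ∑ j, t j * f j x) 2 ν :=
    memLp_finsetSum _ fun j _ => (hf j).const_mul (t j)
  have hfi (j : Fin J) : Integrable (f j) ν := (hf j).integrable (by norm_num)
  have hg0 : ∫ x, ∑ j, t j * f j x ∂ν = 0 := by
    rw [integral_finsetSum _ fun j _ => (hfi j).const_mul (t j)]
    simp [integral_const_mul, h0]
  have hgv : ∫ x, (∑ j, t j * f j x) ^ 2 ∂ν = ∑ j, t j ^ 2 * e j := by
    have hint (i j : Fin J) : Integrable (fun x => t i * f i x * (t j * f j x)) ν :=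
      ((hf i).const_mul (t i)).integrable_mul ((hf j).const_mul (t j))
    simp_rw [sq, Finset.sum_mul_sum]
    rw [integral_finsetSum _ fun i _ => integrable_finsetSum _ fun j _ => hint i j]
    have hc (i j : Fin J) : ∫ x, t i * f i x * (t j * f j x) ∂ν =
        if i = j then t i * t j * e j else 0 := by
      rw [integral_congr_ae (ae_of_all _ fun x => mul_mul_mul_comm (t i) (f i x) (t j) (f j x)),
        integral_const_mul, hcov, mul_ite, mul_zero]
    rw [Finset.sum_congr rfl fun i _ => (integral_finsetSum _ fun j _ => hint i j).trans
      (Finset.sum_congr rfl fun j _ => hc i j)]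
    simp
  -- Cramér–Wold: the characteristic function of the vector at `t` is that of the scalar normalized
  -- sum of `∑ j, t j * f j` at `1`.
  have key := ProbabilityMeasure.tendsto_iff_tendsto_charFun.1
    (tendstoInDistribution_normalizedSum hX hi hg2 hg0).tendsto 1
  simp only [ProbabilityMeasure.coe_mk, Measure.map_id, hgv] at key
  have hlim : charFun (gaussianReal 0 (∑ j, t j ^ 2 * e j).toNNReal) 1 =
      ∏ j, charFun (gaussianReal 0 (e j).toNNReal) (t j) := by
    simp only [charFun_gaussianReal, ← Complex.exp_sum]
    congr 1
    simp only [Complex.ofReal_zero, mul_zero, zero_mul, zero_sub, Finset.sum_neg_distrib]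
    rw [Real.coe_toNNReal _ (Finset.sum_nonneg fun j _ => mul_nonneg (sq_nonneg _) (he j))]
    simp_rw [Real.coe_toNNReal _ (he _)]
    push_cast
    rw [Finset.sum_mul, Finset.sum_div]
    congr 1
    exact Finset.sum_congr rfl fun j _ => by ring
  rw [hlim] at key
  refine key.congr fun n => ?_
  rw [charFun_map_real (aemeasurable_comp_sample hX _), charFun_apply, integral_map
    (aemeasurable_comp_sample hX fun x => WithLp.toLp 2 fun j => normalizedSum (f j) x)
    (by fun_prop)]
  simp_rw [normalizedSum_sum_mul]
  congr 1; funext ω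
  simp [PiLp.inner_apply]

end Sample

/-! ### Weighted series of chi-square variables. -/

section ChiSquareSeries

variable {Ω' : Type*} [MeasurableSpace Ω'] {P' : Measure Ω'}

instance : IsProbabilityMeasure chiSquareOne :=
  Measure.isProbabilityMeasure_map (by fun_prop)

lemma lintegral_enorm_chiSquareOne_ne_top : ∫⁻ x, ‖x‖ₑ ∂chiSquareOne ≠ ⊤ := by
  rw [chiSquareOne, lintegral_map (by fun_prop) (by fun_prop)]
  exact ((memLp_id_gaussianReal (μ := 0) (v := 1) 2).integrable_sq).2.ne

/-- A weighted series of chi-square variables with summable weights converges almost surely. -/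
lemma ae_summable_mul_chiSquare {e : ℕ → ℝ} (he0 : ∀ j, 0 ≤ e j) (he : Summable e)
    {Z : ℕ → Ω' → ℝ} (hZ : ∀ j, HasLaw (Z j) chiSquareOne P') :
    ∀ᵐ ω ∂P', Summable fun j => e j * Z j ω := by
  have hm (j : ℕ) : AEMeasurable (fun ω => ‖e j * Z j ω‖ₑ) P' :=
    ((hZ j).aemeasurable.const_mul _).enorm
  have h : ∫⁻ ω, ∑' j, ‖e j * Z j ω‖ₑ ∂P' ≠ ⊤ := by
    rw [lintegral_tsum hm]
    have (j : ℕ) : ∫⁻ ω, ‖e j * Z j ω‖ₑ ∂P' =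
        ENNReal.ofReal (e j) * ∫⁻ x, ‖x‖ₑ ∂chiSquareOne := by
      simp_rw [enorm_mul]
      rw [lintegral_const_mul'' _ (hZ j).aemeasurable.enorm,
        ← (hZ j).lintegral_comp (f := fun x : ℝ => ‖x‖ₑ) (by fun_prop), Real.enorm_of_nonneg (he0 j)]
    simp_rw [this]
    rw [ENNReal.tsum_mul_right, ← ENNReal.ofReal_tsum_of_nonneg he0 he]
    exact ENNReal.mul_ne_top ENNReal.ofReal_ne_top lintegral_enorm_chiSquareOne_ne_top
  filter_upwards [ae_lt_top' (AEMeasurable.tsum hm) h] with ω hω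
  exact Summable.of_enorm hω.ne

lemma map_mul_chiSquareOne {c : ℝ} (hc : 0 ≤ c) :
    chiSquareOne.map (fun x => c * x) =
      (gaussianReal 0 c.toNNReal).map (fun x => x ^ 2) := by
  have : gaussianReal 0 c.toNNReal = (gaussianReal 0 1).map (√c * ·) := by
    rw [gaussianReal_map_const_mul]
    congr 1
    · simp
    · ext; simp [hc, Real.sq_sqrt]
  rw [this, chiSquareOne, Measure.map_map (by fun_prop) (by fun_prop),
    Measure.map_map (by fun_prop) (by fun_prop)]
  congr 1
  funext x
  simp [mul_pow, Real.sq_sqrt hc]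

/-- Each `e j * Z j` has the law of the square of an `N(0, e j)` variable, and independence makes
the joint law a product. This matches the partial sums of the series with the Gaussian limit of the
central limit theorem. -/
lemma map_sum_mul_chiSquare [IsProbabilityMeasure P'] {J : ℕ} {e : ℕ → ℝ} (he0 : ∀ j, 0 ≤ e j)
    {Z : ℕ → Ω' → ℝ} (hZ : ∀ j, HasLaw (Z j) chiSquareOne P') (hi : iIndepFun Z P') :
    P'.map (fun ω => ∑ j : Fin J, e j * Z j ω) =
      (Measure.pi fun j : Fin J => gaussianReal 0 (e j).toNNReal).map (fun x => ∑ j, x j ^ 2) := by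
  have hm (j : Fin J) : AEMeasurable (fun ω => e j * Z j ω) P' :=
    (hZ j).aemeasurable.const_mul _
  have hind : iIndepFun (fun (j : Fin J) ω => e j * Z j ω) P' :=
    (hi.precomp Fin.val_injective).comp (fun (j : Fin J) x => e j * x) fun j => by fun_prop
  have h1 := (iIndepFun_iff_map_fun_eq_pi_map hm).1 hind
  have h2 (j : Fin J) : P'.map (fun ω => e j * Z j ω) =
      (gaussianReal 0 (e j).toNNReal).map (fun x => x ^ 2) := by
    rw [← map_mul_chiSquareOne (he0 j), ← (hZ j).map_eq,
      AEMeasurable.map_map_of_aemeasurable (by fun_prop) (hZ j).aemeasurable]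
    rfl
  rw [show (fun j : Fin J => P'.map fun ω => e j * Z j ω) = fun j : Fin J =>
    (gaussianReal 0 (e j).toNNReal).map (fun x => x ^ 2) from funext h2] at h1
  have hsq (j : Fin J) : IsProbabilityMeasure ((gaussianReal 0 (e j).toNNReal).map
      (fun x : ℝ => x ^ 2)) := Measure.isProbabilityMeasure_map (by fun_prop)
  rw [← Measure.pi_map_pi (f := fun (_ : Fin J) (x : ℝ) => x ^ 2) fun j => by fun_prop] at h1
  have h3 := congrArg (fun m => m.map fun y : Fin J → ℝ => ∑ j, y j) h1
  rw [AEMeasurable.map_map_of_aemeasurable (by fun_prop) (aemeasurable_pi_lambda _ hm),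
    Measure.map_map (by fun_prop) (by fun_prop)] at h3
  exact h3

end ChiSquareSeries

/-! ### Limit law of the squared norm of a normalized sum in a Hilbert space. -/

section LimitTheorem

variable {Ω Ω' : Type*} [MeasurableSpace Ω] [MeasurableSpace Ω'] {P : Measure Ω}
  [IsProbabilityMeasure P] {P' : Measure Ω'} [IsProbabilityMeasure P']
  {ν : Measure (ℕ × ℕ)} [IsProbabilityMeasure ν] {X : ℕ → Ω → ℕ × ℕ}
  {H : Type*} [NormedAddCommGroup H] [InnerProductSpace ℝ H] [CompleteSpace H]
  {V : ℕ × ℕ → H} {e : ℕ → ℝ} {ψ : ℕ → H}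

omit [CompleteSpace H] in
lemma IsEigenSystem.sum_inner_sq_le {T : H →L[ℝ] H} (h : IsEigenSystem T e ψ) (y : H) (J : ℕ) :
    ∑ j : Fin J, inner ℝ (ψ j) y ^ 2 ≤ ‖y‖ ^ 2 := by
  classical
  rw [Fin.sum_univ_eq_sum_range (fun j => inner ℝ (ψ j) y ^ 2) J,
    ← Finset.sum_filter_of_ne (p := fun j => e j ≠ 0),
    ← Finset.sum_subtype_eq_sum_filter]
  · simpa using h.orthonormal.sum_inner_products_le (s := (Finset.range J).subtype _) y
  · intro j _ hj hej
    rw [h.eq_zero j hej] at hj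
    simp at hj

/-- The squared norm of a normalized sum of iid centred random elements of a Hilbert space
converges in law to a weighted series of chi-square variables, the weights being the eigenvalues
of the covariance operator. -/
theorem tendstoInDistribution_norm_sq_normalizedSum (hX : ∀ i, HasLaw (X i) ν P)
    (hi : iIndepFun X P) (hV : MemLp V 2 ν) (h0 : ∫ x, V x ∂ν = 0)
    (h : IsEigenSystem (covOp ν V) e ψ) {Z : ℕ → Ω' → ℝ}
    (hZ : ∀ j, HasLaw (Z j) chiSquareOne P') (hZi : iIndepFun Z P') :
    TendstoInDistribution (fun (n : ℕ) ω => ‖normalizedSum V (sample X n ω)‖ ^ 2) atTop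
      (fun ω => ∑' j, e j * Z j ω) (fun _ => P) P' := by
  have he0 := h.nonneg hV
  have hsum := h.hasSum_eigenvalues hV
  have hψ2 (j : ℕ) : MemLp (fun x => inner ℝ (ψ j) (V x)) 2 ν := hV.const_inner (ψ j)
  have hψ0 (j : ℕ) : ∫ x, inner ℝ (ψ j) (V x) ∂ν = 0 := by
    rw [integral_inner (hV.integrable (by norm_num)), h0, inner_zero_right]
  -- `Y` keeps the first `J` squared coordinates in the eigenbasis. For `n ≠ 0` the mean of what is
  -- dropped equals `E ‖V‖²` minus the first `J` eigenvalues, whatever `n`; by the trace formula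
  -- this `ε J` tends to `0`.
  refine tendstoInDistribution_of_approx
    (Y := fun J n ω => ∑ j : Fin J, inner ℝ (ψ j) (normalizedSum V (sample X n ω)) ^ 2)
    (T := fun J ω => ∑ j : Fin J, e j * Z j ω)
    (ε := fun J => ∫ x, ‖V x‖ ^ 2 ∂ν - ∑ j : Fin J, e j)
    (fun n => aemeasurable_comp_sample hX fun x => ‖normalizedSum V x‖ ^ 2) (fun J => ?_) ?_ ?_
    (fun J n => ?_) fun J n => ?_
  · have hclt := tendstoInDistribution_normalizedSum_pi hX hi (J := J)
      (f := fun j x => inner ℝ (ψ j) (V x)) (e := fun j => e j) (fun j => hψ2 j) (fun j => hψ0 j)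
      (fun j => he0 j) fun i j => by
        rw [h.integral_inner_mul_inner hV]; simp [Fin.ext_iff]
    have := hclt.continuous_comp (g := fun y : EuclideanSpace ℝ (Fin J) => ∑ j, y j ^ 2)
      (by fun_prop)
    have := TendstoInDistribution.of_map_eq this
      (Z := fun ω => ∑ j : Fin J, e j * Z j ω) (P'' := P')
      (Finset.aemeasurable_fun_sum _ fun j _ => (hZ j).aemeasurable.const_mul _)
      (map_sum_mul_chiSquare he0 hZ hZi).symm
    convert this using 3 with n ω
    simp [inner_normalizedSum]
  · filter_upwards [ae_summable_mul_chiSquare he0 hsum.summable hZ] with ω hω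
    simp_rw [fun J => Fin.sum_univ_eq_sum_range (fun j => e j * Z j ω) J]
    exact hω.hasSum.tendsto_sum_nat
  · simp_rw [fun J => Fin.sum_univ_eq_sum_range e J]
    have := (tendsto_const_nhds (x := ∫ x, ‖V x‖ ^ 2 ∂ν)).sub hsum.tendsto_sum_nat
    rwa [sub_self] at this
  all_goals
    have hA := integral_norm_sq_normalizedSum_le hX hi hV h0 n
    have hB (j : Fin J) : Integrable (fun ω =>
        (inner ℝ (ψ j) (normalizedSum V (sample X n ω)) : ℝ) ^ 2) P := by
      simp_rw [inner_normalizedSum]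
      simpa using (integral_norm_sq_normalizedSum_le hX hi (hψ2 j) (hψ0 j) n).1
  · exact hA.1.sub (integrable_finsetSum _ fun j _ => hB j)
  · simp_rw [abs_of_nonneg (sub_nonneg.2 (h.sum_inner_sq_le _ J))]
    rw [integral_sub hA.1 (integrable_finsetSum _ fun j _ => hB j),
      integral_finsetSum _ fun j _ => hB j]
    rcases eq_or_ne n 0 with rfl | hn
    · have := sum_le_hasSum (Finset.range J) (fun j _ => he0 j) hsum
      rw [← Fin.sum_univ_eq_sum_range e J] at this
      simpa [normalizedSum] using this
    · rw [(integral_norm_sq_normalizedSum hX hi hV h0 hn).2]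
      refine le_of_eq ?_
      congr 1
      refine Finset.sum_congr rfl fun j _ => ?_
      simp_rw [inner_normalizedSum]
      have h1 := (integral_norm_sq_normalizedSum hX hi (hψ2 j) (hψ0 j) hn).2
      have h2 := h.integral_inner_mul_inner hV j j
      simp only [Real.norm_eq_abs, sq_abs] at h1
      rw [h1]
      simpa [sq] using h2

end LimitTheorem

/-! ### The generating function of the bivariate Hermite law. -/

section GeneratingFunction

/-- The bivariate Poisson probabilities without the normalizing exponential factor. -/
def poissonWeight (a b c : ℝ) (x : ℕ × ℕ) : ℝ :=
  ∑ k ∈ Finset.range (min x.1 x.2 + 1),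
    a ^ (x.1 - k) / (x.1 - k).factorial * (b ^ (x.2 - k) / (x.2 - k).factorial) *
      (c ^ k / k.factorial)

lemma hasSum_mul_mul {f g h : ℕ → ℝ} {a b c : ℝ} (hf : HasSum f a) (hg : HasSum g b)
    (hh : HasSum h c) :
    HasSum (fun p : (ℕ × ℕ) × ℕ => f p.1.1 * g p.1.2 * h p.2) (a * b * c) := by
  have hfg : Summable fun x : ℕ × ℕ => f x.1 * g x.2 :=
    summable_mul_of_summable_norm (f := f) (g := g) hf.summable.norm hg.summable.norm
  have hfg' : HasSum (fun x : ℕ × ℕ => f x.1 * g x.2) (a * b) := hf.mul hg hfg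
  exact hfg'.mul hh (summable_mul_of_summable_norm (f := fun x : ℕ × ℕ => f x.1 * g x.2) (g := h)
    hfg.norm hh.summable.norm)

/-- This is the representation `(I + K, J + K)` of a bivariate Poisson vector: the product of three
exponential series is regrouped along the fibres of `((i, j), k) ↦ (i + k, j + k)`. -/
lemma hasSum_poissonWeight (a b c : ℝ) :
    HasSum (poissonWeight a b c) (Real.exp (a + b + c)) := by
  have hexp (a : ℝ) : HasSum (fun n : ℕ => a ^ n / n.factorial) (Real.exp a) := by
    rw [Real.exp_eq_exp_ℝ]
    exact NormedSpace.expSeries_div_hasSum_exp a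
  have habc := hasSum_mul_mul (hexp a) (hexp b) (hexp c)
  rw [← Real.exp_add, ← Real.exp_add] at habc
  have := habc.tsum_fiberwise fun p : (ℕ × ℕ) × ℕ => (p.1.1 + p.2, p.1.2 + p.2)
  refine Eq.mp (congrArg (HasSum · _) (funext fun x => ?_)) this
  obtain ⟨r, s⟩ := x
  have hfib : (fun p : (ℕ × ℕ) × ℕ => (p.1.1 + p.2, p.1.2 + p.2)) ⁻¹' {(r, s)} =
      ((Finset.range (min r s + 1)).image fun k => ((r - k, s - k), k) : Finset _) := by
    ext ⟨⟨i, j⟩, k⟩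
    simp only [Set.mem_preimage, Set.mem_singleton_iff, Prod.mk.injEq, Finset.coe_image,
      Finset.coe_range, Set.mem_image, Set.mem_Iio]
    constructor
    · rintro ⟨rfl, rfl⟩
      exact ⟨k, by omega, ⟨by omega, by omega⟩, rfl⟩
    · rintro ⟨k, hk, ⟨rfl, rfl⟩, rfl⟩
      omega
  rw [hfib, Finset.tsum_subtype' _ (fun p : (ℕ × ℕ) × ℕ =>
    a ^ p.1.1 / p.1.1.factorial * (b ^ p.1.2 / p.1.2.factorial) * (c ^ p.2 / p.2.factorial)),
    Finset.sum_image]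
  · simp only [poissonWeight]
  · intro k _ l _ hkl
    exact congrArg Prod.snd hkl

lemma pow_mul_poissonWeight (a b c u v : ℝ) (x : ℕ × ℕ) :
    u ^ x.1 * v ^ x.2 * poissonWeight a b c x = poissonWeight (a * u) (b * v) (c * (u * v)) x := by
  rw [poissonWeight, poissonWeight, Finset.mul_sum]
  refine Finset.sum_congr rfl fun k hk => ?_
  have h1 : k ≤ x.1 := by simp at hk; omega
  have h2 : k ≤ x.2 := by simp at hk; omega
  obtain ⟨i, hi⟩ := Nat.exists_eq_add_of_le h1
  obtain ⟨j, hj⟩ := Nat.exists_eq_add_of_le h2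
  rw [hi, hj, Nat.add_sub_cancel_left, Nat.add_sub_cancel_left]
  simp only [mul_pow, pow_add]
  ring

lemma abs_poissonWeight_le (a b c : ℝ) (x : ℕ × ℕ) :
    |poissonWeight a b c x| ≤ poissonWeight |a| |b| |c| x := by
  refine (Finset.abs_sum_le_sum_abs _ _).trans_eq (Finset.sum_congr rfl fun k _ => ?_)
  simp [abs_mul, abs_div]

lemma continuous_poissonWeight (a b c : ℝ) (x : ℕ × ℕ) :
    Continuous fun δ : ℝ => poissonWeight (δ * a) (δ * b) (δ * c) x := by
  unfold poissonWeight
  fun_prop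

lemma integrable_exp_mul_abs_gaussianReal (m : ℝ) (v : NNReal) (c : ℝ) :
    Integrable (fun δ => Real.exp (c * |δ|)) (gaussianReal m v) :=
  integrable_exp_mul_abs (integrable_exp_mul_gaussianReal c) (integrable_exp_mul_gaussianReal (-c))

lemma abs_pow_mul_pow_le_one {t : ℝ × ℝ} (ht : t ∈ unitSquare) (x : ℕ × ℕ) :
    |t.1 ^ x.1 * t.2 ^ x.2| ≤ 1 := by
  obtain ⟨⟨h1, h1'⟩, h2, h2'⟩ := ht
  rw [abs_of_nonneg (by positivity)]
  exact mul_le_one₀ (pow_le_one₀ h1 h1') (by positivity) (pow_le_one₀ h2 h2')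

/-- The function `v(·; θ)` is the probability generating function of `BH(θ)`. -/
theorem integral_pow_mul_pow {θ : Param} (hθ : 0 ≤ θ 1) {ν : Measure (ℕ × ℕ)}
    (hν : IsBivariateHermite θ ν) {t : ℝ × ℝ} (ht : t ∈ unitSquare) :
    ∫ x, t.1 ^ x.1 * t.2 ^ x.2 ∂ν = pgf θ t := by
  obtain ⟨hprob, hmass⟩ := hν
  set γ := gaussianReal (θ 0) (θ 1).toNNReal with hγ
  set Λ := θ 2 + θ 3 + θ 4 with hΛ
  set Λ' := |θ 2| + |θ 3| + |θ 4| with hΛ'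
  have hint : Integrable (fun x : ℕ × ℕ => t.1 ^ x.1 * t.2 ^ x.2) ν :=
    Integrable.of_bound .of_discrete 1 (ae_of_all _ fun x => abs_pow_mul_pow_le_one ht x)
  let F (x : ℕ × ℕ) (δ : ℝ) : ℝ := Real.exp (-(δ * Λ)) *
    (t.1 ^ x.1 * t.2 ^ x.2 * poissonWeight (δ * θ 2) (δ * θ 3) (δ * θ 4) x)
  -- For negative `δ` the Poisson formula takes both signs, so sum and integral are exchanged by
  -- domination: the bounds sum over `x` to at most `exp (2 Λ' |δ|)`, which is Gaussian integrable.
  let bound (x : ℕ × ℕ) (δ : ℝ) : ℝ := Real.exp (-(δ * Λ)) *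
    poissonWeight |δ * θ 2| |δ * θ 3| |δ * θ 4| x
  have hbs (δ : ℝ) : HasSum (fun x => bound x δ)
      (Real.exp (-(δ * Λ)) * Real.exp (|δ * θ 2| + |δ * θ 3| + |δ * θ 4|)) :=
    (hasSum_poissonWeight _ _ _).mul_left _
  have hF := hasSum_integral_of_dominated_convergence (μ := γ) (F := F)
    (f := fun δ => Real.exp (lam θ t * δ)) bound
    (fun x => by
      refine Continuous.aestronglyMeasurable ?_
      exact (by fun_prop : Continuous fun δ : ℝ => Real.exp (-(δ * Λ))).mul
        ((continuous_poissonWeight _ _ _ x).const_mul _))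
    (fun x => ae_of_all _ fun δ => by
      simp only [F, bound, norm_mul, Real.norm_eq_abs, Real.abs_exp]
      gcongr
      rw [← abs_mul]
      calc _ ≤ 1 * _ := mul_le_mul_of_nonneg_right (abs_pow_mul_pow_le_one ht x) (abs_nonneg _)
        _ ≤ _ := by rw [one_mul]; exact abs_poissonWeight_le _ _ _ x)
    (ae_of_all _ fun δ => (hbs δ).summable)
    (by
      simp_rw [fun δ => (hbs δ).tsum_eq]
      refine (integrable_exp_mul_abs_gaussianReal (θ 0) (θ 1).toNNReal (2 * Λ')).mono'
        (by fun_prop) (ae_of_all _ fun δ => ?_)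
      rw [← Real.exp_add, Real.norm_eq_abs, Real.abs_exp]
      refine Real.exp_le_exp.2 ?_
      have h1 : |δ * Λ| ≤ |δ| * Λ' := by
        rw [abs_mul]
        gcongr
        exact abs_add_three _ _ _
      have h2 := neg_abs_le (δ * Λ)
      have h3 : |δ * θ 2| + |δ * θ 3| + |δ * θ 4| = |δ| * Λ' := by
        rw [hΛ']; simp only [abs_mul]; ring
      linarith)
    (ae_of_all _ fun δ => by
      have := (hasSum_poissonWeight (δ * θ 2 * t.1) (δ * θ 3 * t.2)
        (δ * θ 4 * (t.1 * t.2))).mul_left (Real.exp (-(δ * Λ)))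
      simp_rw [← pow_mul_poissonWeight] at this
      rw [← Real.exp_add] at this
      rwa [show -(δ * Λ) + (δ * θ 2 * t.1 + δ * θ 3 * t.2 + δ * θ 4 * (t.1 * t.2)) =
        lam θ t * δ by rw [lam, hΛ]; ring] at this)
  rw [integral_countable hint]
  have hterm (x : ℕ × ℕ) : ∫ δ, F x δ ∂γ = ν.real {x} • (t.1 ^ x.1 * t.2 ^ x.2) := by
    rw [← Prod.mk.eta (p := x), hmass, smul_eq_mul, ← integral_mul_const]
    congr 1; funext δ
    simp only [F, bivariatePoissonPMF, poissonWeight, hΛ]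
    ring_nf
  simp_rw [← hterm]
  rw [hF.tsum_eq]
  -- For fixed `δ` the Poisson generating function is `exp (λ(t) δ)`; mixing over `δ` gives the
  -- Gaussian moment generating function at `λ(t)`.
  have hmgf := mgf_gaussianReal (p := γ) (X := id) (by rw [Measure.map_id]) (lam θ t)
  simp only [mgf, id] at hmgf
  rw [hmgf, pgf, Real.coe_toNNReal _ hθ]
  congr 1; ring

end GeneratingFunction

/-! ### Uniform first-order expansion of `v(t; θ)` in the parameter. -/

section Taylor

lemma abs_sub_one_le_of_mem {a : ℝ} (ha : a ∈ Set.Icc (0 : ℝ) 1) : |a - 1| ≤ 1 := by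
  rw [abs_le]; constructor <;> linarith [ha.1, ha.2]

lemma abs_lam_le (θ : Param) {t : ℝ × ℝ} (ht : t ∈ unitSquare) :
    |lam θ t| ≤ |θ 2| + |θ 3| + |θ 4| := by
  have h3 : |t.1 * t.2 - 1| ≤ 1 := abs_sub_one_le_of_mem
    ⟨mul_nonneg ht.1.1 ht.2.1, mul_le_one₀ ht.1.2 ht.2.1 ht.2.2⟩
  rw [lam]
  refine (abs_add_three _ _ _).trans ?_
  simp only [abs_mul]
  gcongr ?_ + ?_ + ?_
  · exact mul_le_of_le_one_right (abs_nonneg _) (abs_sub_one_le_of_mem ht.1)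
  · exact mul_le_of_le_one_right (abs_nonneg _) (abs_sub_one_le_of_mem ht.2)
  · exact mul_le_of_le_one_right (abs_nonneg _) h3

lemma lam_sub (θ' θ : Param) (t : ℝ × ℝ) : lam (θ' - θ) t = lam θ' t - lam θ t := by
  simp only [lam, PiLp.sub_apply]; ring

lemma continuous_pgf (θ : Param) : Continuous (pgf θ) := by
  unfold pgf lam; fun_prop

lemma continuous_gradVec (θ : Param) (k : Fin 5) : Continuous fun t => gradVec θ t k := by
  fin_cases k <;> simp [gradVec, lam, eta] <;> fun_prop

lemma isCompact_unitSquare : IsCompact unitSquare := isCompact_Icc.prod isCompact_Icc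

/-- The linear part of the increment of the exponent of `v`, and the remainder. -/
lemma abs_exponent_sub_le {m s x l a b D L : ℝ} (ha : |a| ≤ D) (hb : |b| ≤ D) (hl : |l| ≤ 3 * D)
    (hx : |x| ≤ L) (hD1 : D ≤ 1) :
    |x * a + 1 / 2 * x ^ 2 * b + (m + s * x) * l| ≤ (L + L ^ 2 + 3 * (|m| + |s| * L)) * D ∧
      |(m + a) * (x + l) + 1 / 2 * (s + b) * (x + l) ^ 2 - (m * x + 1 / 2 * s * x ^ 2) -
        (x * a + 1 / 2 * x ^ 2 * b + (m + s * x) * l)| ≤ (8 + 5 * |s| + 3 * L) * D ^ 2 := by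
  have hD0 : 0 ≤ D := (abs_nonneg _).trans ha
  have hL0 : 0 ≤ L := (abs_nonneg _).trans hx
  have hhalf : |(1 / 2 : ℝ)| = 1 / 2 := abs_of_pos (by norm_num)
  have hll : |l * l| ≤ 9 * D ^ 2 := by
    rw [abs_mul]
    calc _ ≤ (3 * D) * (3 * D) := by gcongr
      _ = _ := by ring
  constructor
  · have e1 : |x * a| ≤ L * D := by
      rw [abs_mul]; gcongr
    have e2 : |1 / 2 * x ^ 2 * b| ≤ L ^ 2 * D := by
      rw [abs_mul, abs_mul, hhalf, abs_pow]
      calc _ ≤ 1 * L ^ 2 * D := by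
            gcongr
            norm_num
        _ = _ := by ring
    have e3 : |(m + s * x) * l| ≤ 3 * (|m| + |s| * L) * D := by
      rw [abs_mul]
      calc _ ≤ (|m| + |s| * L) * (3 * D) := by
            gcongr
            refine (abs_add_le _ _).trans ?_
            rw [abs_mul]; gcongr
        _ = _ := by ring
    refine (abs_add_three _ _ _).trans ?_
    linarith
  · have e1 : |a * l| ≤ 3 * D ^ 2 := by
      rw [abs_mul]
      calc _ ≤ D * (3 * D) := by gcongr
        _ = _ := by ring
    have e2 : |1 / 2 * s * (l * l)| ≤ 5 * |s| * D ^ 2 := by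
      rw [abs_mul, abs_mul, hhalf]
      calc _ ≤ 1 / 2 * |s| * (9 * D ^ 2) := by gcongr
        _ ≤ _ := by nlinarith [mul_nonneg (abs_nonneg s) (sq_nonneg D)]
    have e3 : |b * (x * l)| ≤ 3 * L * D ^ 2 := by
      rw [abs_mul, abs_mul]
      calc _ ≤ D * (L * (3 * D)) := by gcongr
        _ = _ := by ring
    have e4 : |1 / 2 * b * (l * l)| ≤ 5 * D ^ 2 := by
      rw [abs_mul, abs_mul, hhalf]
      calc _ ≤ 1 / 2 * 1 * (9 * D ^ 2) := by gcongr; exact hb.trans hD1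
        _ ≤ _ := by nlinarith [sq_nonneg D]
    have : (m + a) * (x + l) + 1 / 2 * (s + b) * (x + l) ^ 2 - (m * x + 1 / 2 * s * x ^ 2) -
        (x * a + 1 / 2 * x ^ 2 * b + (m + s * x) * l) =
        a * l + 1 / 2 * s * (l * l) + b * (x * l) + 1 / 2 * b * (l * l) := by ring
    rw [this]
    refine (abs_add_le _ _).trans ((add_le_add (abs_add_three _ _ _) le_rfl).trans ?_)
    linarith

/-- Here `d` is the increment of the exponent and `g` its linear part. The error splits into `exp d
- 1 - d`, at most `d²` for `|d| ≤ 1`, and `d - g`; both are quadratic in `D`. -/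
lemma abs_exp_mul_sub_le {v B d g D G K : ℝ} (hv : |v| ≤ B) (hD1 : D ≤ 1)
    (hK0 : 0 ≤ K) (hD0 : 0 ≤ D) (hDGK : (G + K) * D ≤ 1) (hg : |g| ≤ G * D)
    (hdg : |d - g| ≤ K * D ^ 2) :
    |v * Real.exp d - v - v * g| ≤ B * ((G + K) ^ 2 + K) * D ^ 2 := by
  have hd_le : |d| ≤ (G + K) * D := by
    have h1 : |d| ≤ |g| + |d - g| := by
      simpa using abs_add_le g (d - g)
    have h2 : K * D ^ 2 ≤ K * D := by
      have : D ^ 2 ≤ D := by nlinarith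
      gcongr
    linarith
  have hexp := Real.abs_exp_sub_one_sub_id_le (hd_le.trans hDGK)
  have hfin : v * Real.exp d - v - v * g = v * ((Real.exp d - 1 - d) + (d - g)) := by ring
  rw [hfin, abs_mul]
  have hd2 : d ^ 2 ≤ (G + K) ^ 2 * D ^ 2 := by
    rw [← mul_pow, ← sq_abs]
    gcongr
  calc _ ≤ B * ((G + K) ^ 2 * D ^ 2 + K * D ^ 2) := by
        have := (abs_nonneg _).trans hv
        gcongr
        exact (abs_add_le _ _).trans (add_le_add (hexp.trans hd2) hdg)
    _ = _ := by ring

/-- First-order expansion of `v(t; ·)` with a remainder that is quadratic uniformly in `t`. -/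
theorem exists_abs_pgf_sub_le (θ : Param) : ∃ C ≥ 0, ∃ ρ > 0, ∀ θ' : Param, ‖θ' - θ‖ ≤ ρ →
    ∀ t ∈ unitSquare,
      |pgf θ' t - pgf θ t - pgf θ t * ∑ k, gradVec θ t k * (θ' - θ) k| ≤ C * ‖θ' - θ‖ ^ 2 := by
  obtain ⟨B, hB⟩ := isCompact_unitSquare.exists_bound_of_continuousOn (continuous_pgf θ).continuousOn
  have hB0 : 0 ≤ B := (norm_nonneg _).trans (hB (0, 0) (by simp [unitSquare]))
  obtain ⟨L, hL⟩ : ∃ L, L = |θ 2| + |θ 3| + |θ 4| := ⟨_, rfl⟩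
  have hL0 : 0 ≤ L := by rw [hL]; positivity
  obtain ⟨K, hK⟩ : ∃ K, K = 8 + 5 * |θ 1| + 3 * L := ⟨_, rfl⟩
  obtain ⟨G, hG⟩ : ∃ G, G = L + L ^ 2 + 3 * (|θ 0| + |θ 1| * L) := ⟨_, rfl⟩
  have hK0 : 8 ≤ K := by
    have : 0 ≤ 5 * |θ 1| + 3 * L := by positivity
    linarith
  have hG0 : 0 ≤ G := by rw [hG]; positivity
  -- This radius keeps the exponent increment below `1`, as the bound for `exp` requires; because `K
  -- ≥ 8` it also gives `‖θ' - θ‖ ≤ 1`.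
  refine ⟨B * ((G + K) ^ 2 + K), by positivity, 1 / (G + K), by positivity, ?_⟩
  intro θ' hθ' t ht
  have hDGK : ‖θ' - θ‖ * (G + K) ≤ 1 := by rwa [le_div_iff₀ (by positivity)] at hθ'
  have hD1 : ‖θ' - θ‖ ≤ 1 := by nlinarith [norm_nonneg (θ' - θ)]
  have hΔ (k : Fin 5) : |(θ' - θ) k| ≤ ‖θ' - θ‖ := PiLp.norm_apply_le (θ' - θ) k
  have hlD : |lam (θ' - θ) t| ≤ 3 * ‖θ' - θ‖ :=
    (abs_lam_le _ ht).trans (by linarith [hΔ 2, hΔ 3, hΔ 4])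
  obtain ⟨h1, h2⟩ := abs_exponent_sub_le (m := θ 0) (s := θ 1) (hΔ 0) (hΔ 1) hlD
    ((abs_lam_le θ ht).trans_eq hL.symm) hD1
  rw [← hG] at h1
  rw [← hK] at h2
  have key := abs_exp_mul_sub_le (hB t ht) hD1 (by linarith) (norm_nonneg _)
    (by rwa [mul_comm]) h1 h2
  have hgrad : ∑ k, gradVec θ t k * (θ' - θ) k = lam θ t * (θ' - θ) 0 +
      1 / 2 * lam θ t ^ 2 * (θ' - θ) 1 + (θ 0 + θ 1 * lam θ t) * lam (θ' - θ) t := by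
    rw [Fin.sum_univ_five, lam.eq_1 (θ' - θ)]
    simp only [gradVec, eta, Matrix.cons_val]
    ring
  have hpgf : pgf θ' t = pgf θ t * Real.exp
      ((θ 0 + (θ' - θ) 0) * (lam θ t + lam (θ' - θ) t) +
        1 / 2 * (θ 1 + (θ' - θ) 1) * (lam θ t + lam (θ' - θ) t) ^ 2 -
        (θ 0 * lam θ t + 1 / 2 * θ 1 * lam θ t ^ 2)) := by
    rw [pgf, pgf, ← Real.exp_add, lam_sub]
    simp only [PiLp.sub_apply]
    congr 1; ring
  rwa [hgrad, hpgf]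

end Taylor

/-! ### Continuous functions as elements of `L²(m)`. -/

section WeightedSpace

variable {m : Measure (ℝ × ℝ)} [IsFiniteMeasure m]

lemma memLp_continuousMap (hm : ∀ᵐ t ∂m, t ∈ unitSquare) (f : C(ℝ × ℝ, ℝ)) : MemLp f 2 m := by
  obtain ⟨B, hB⟩ := isCompact_unitSquare.exists_bound_of_continuousOn f.continuous.continuousOn
  exact MemLp.of_bound f.continuous.aestronglyMeasurable B (hm.mono hB)

/-- The class of a continuous function in `L²(m)`, for a measure `m` carried by the unit square. -/
def toL2 (hm : ∀ᵐ t ∂m, t ∈ unitSquare) : C(ℝ × ℝ, ℝ) →ₗ[ℝ] Lp ℝ 2 m where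
  toFun f := (memLp_continuousMap hm f).toLp f
  map_add' _ _ := rfl
  map_smul' _ _ := rfl

lemma coeFn_toL2 (hm : ∀ᵐ t ∂m, t ∈ unitSquare) (f : C(ℝ × ℝ, ℝ)) : toL2 hm f =ᵐ[m] f :=
  (memLp_continuousMap hm f).coeFn_toLp

lemma inner_left_toL2 (hm : ∀ᵐ t ∂m, t ∈ unitSquare) (c : Lp ℝ 2 m) (f : C(ℝ × ℝ, ℝ)) :
    inner ℝ c (toL2 hm f) = ∫ t, c t * f t ∂m := by
  rw [L2.inner_def]
  refine integral_congr_ae ((coeFn_toL2 hm f).mono fun t ht => ?_)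
  simp only [ht]
  exact mul_comm _ _

lemma inner_toL2_toL2 (hm : ∀ᵐ t ∂m, t ∈ unitSquare) (f g : C(ℝ × ℝ, ℝ)) :
    inner ℝ (toL2 hm f) (toL2 hm g) = ∫ t, f t * g t ∂m := by
  rw [inner_left_toL2]
  exact integral_congr_ae ((coeFn_toL2 hm f).mono fun t ht => by simp only [ht])

lemma norm_sq_toL2 (hm : ∀ᵐ t ∂m, t ∈ unitSquare) (f : C(ℝ × ℝ, ℝ)) :
    ‖toL2 hm f‖ ^ 2 = ∫ t, f t ^ 2 ∂m := by
  rw [← real_inner_self_eq_norm_sq, inner_toL2_toL2]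
  simp_rw [sq]

lemma norm_toL2_le (hm : ∀ᵐ t ∂m, t ∈ unitSquare) {f : C(ℝ × ℝ, ℝ)} {c : ℝ} (hc : 0 ≤ c)
    (hf : ∀ t ∈ unitSquare, |f t| ≤ c) :
    ‖toL2 hm f‖ ≤ (measureUnivNNReal m : ℝ) ^ (2 : ENNReal).toReal⁻¹ * c := by
  refine Lp.norm_le_of_ae_bound hc ?_
  filter_upwards [hm, coeFn_toL2 hm f] with t ht hft
  rw [hft]
  exact hf t ht

end WeightedSpace

/-! ### The measure with density `w` on the unit square. -/

section Weight

variable {w : ℝ × ℝ → ℝ}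

/-- The measure `w(t) dt` on the unit square. -/
def weightMeasure (w : ℝ × ℝ → ℝ) : Measure (ℝ × ℝ) :=
  (volume.restrict unitSquare).withDensity fun t => ENNReal.ofReal (w t)

lemma measurableSet_unitSquare : MeasurableSet unitSquare := measurableSet_Icc.prod measurableSet_Icc

lemma isFiniteMeasure_weightMeasure (hw : IntegrableOn w unitSquare) :
    IsFiniteMeasure (weightMeasure w) :=
  isFiniteMeasure_withDensity_ofReal hw.2

lemma ae_mem_unitSquare (w : ℝ × ℝ → ℝ) : ∀ᵐ t ∂weightMeasure w, t ∈ unitSquare :=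
  (withDensity_absolutelyContinuous _ _).ae_le (ae_restrict_mem measurableSet_unitSquare)

lemma integral_weightMeasure (hw0 : ∀ t ∈ unitSquare, 0 ≤ w t) (hw : IntegrableOn w unitSquare)
    (f : ℝ × ℝ → ℝ) : ∫ t, f t ∂weightMeasure w = ∫ t in unitSquare, f t * w t := by
  rw [weightMeasure, integral_withDensity_eq_integral_toReal_smul₀
    hw.aestronglyMeasurable.aemeasurable.ennreal_ofReal (by simp)]
  refine integral_congr_ae ((ae_restrict_mem measurableSet_unitSquare).mono fun t ht => ?_)
  simp only [ENNReal.toReal_ofReal (hw0 t ht), smul_eq_mul]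
  exact mul_comm _ _

lemma memH_of_continuous (hw : IntegrableOn w unitSquare) {f : ℝ × ℝ → ℝ} (hf : Continuous f) :
    MemH w f :=
  ⟨hf.aestronglyMeasurable, hw.continuousOn_mul (hf.pow 2).continuousOn isCompact_unitSquare⟩

end Weight

/-! ### The random element `V⁰` of `L²(m)`: algebra, moments, centring. -/

section Influence

/-- The monomial `t₁^{x₁} t₂^{x₂}` as a continuous function of `t`. -/
def monomialMap (x : ℕ × ℕ) : C(ℝ × ℝ, ℝ) := ⟨fun t => t.1 ^ x.1 * t.2 ^ x.2, by fun_prop⟩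

/-- The function `v(·; θ)` as a continuous map. -/
def pgfMap (θ : Param) : C(ℝ × ℝ, ℝ) := ⟨pgf θ, continuous_pgf θ⟩

/-- The partial derivatives of `v(·; θ)` in `θ`, as continuous maps. -/
def gradMap (θ : Param) (k : Fin 5) : C(ℝ × ℝ, ℝ) :=
  ⟨fun t => pgf θ t * gradVec θ t k, (continuous_pgf θ).mul (continuous_gradVec θ k)⟩

variable (ℓ : ℕ × ℕ → parameterSpace → Param) (θ : parameterSpace)

/-- The function `V⁰(x; θ; ·)` as a continuous map. -/
def V0Map (x : ℕ × ℕ) : C(ℝ × ℝ, ℝ) :=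
  monomialMap x - pgfMap θ - ∑ k, ℓ x θ k • gradMap θ k

lemma V0Map_apply (x : ℕ × ℕ) (t : ℝ × ℝ) : V0Map ℓ θ x t = V0 ℓ θ x t := by
  have : V0Map ℓ θ x t = t.1 ^ x.1 * t.2 ^ x.2 - pgf θ t -
      ∑ k, ℓ x θ k * (pgf θ t * gradVec θ t k) := by
    simp [V0Map, monomialMap, pgfMap, gradMap]
  rw [this, V0, mul_add, mul_one, ← sub_sub, Finset.mul_sum]
  congr 1
  exact Finset.sum_congr rfl fun k _ => by ring

/-- `Wₙ` as a continuous map. -/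
def WMap {n : ℕ} (x : Fin n → ℕ × ℕ) : C(ℝ × ℝ, ℝ) := (1 / √(n : ℝ)) • ∑ i, V0Map ℓ θ (x i)

lemma WMap_apply {n : ℕ} (x : Fin n → ℕ × ℕ) (t : ℝ × ℝ) : WMap ℓ θ x t = W ℓ θ x t := by
  simp [WMap, W, V0Map_apply]

/-- The empirical process as a continuous map. -/
def empMap {n : ℕ} (x : Fin n → ℕ × ℕ) (θ : Param) : C(ℝ × ℝ, ℝ) :=
  √(n : ℝ) • ((1 / (n : ℝ)) • ∑ i, monomialMap (x i) - pgfMap θ)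

lemma empMap_apply {n : ℕ} (x : Fin n → ℕ × ℕ) (θ : Param) (t : ℝ × ℝ) :
    empMap x θ t = empProcess x θ t := by
  simp [empMap, empProcess, epgf, monomialMap, pgfMap]

/-- The exact identity behind the expansion: the first term is `√n` times the Taylor remainder of
`v`, the second pairs the gradient with the remainder of the linear representation. The monomials
cancel. -/
lemma empProcess_sub_W {n : ℕ} (x : Fin n → ℕ × ℕ) (θ' : Param) (t : ℝ × ℝ) :
    empProcess x θ' t - W ℓ θ x t =
      -(√(n : ℝ) * (pgf θ' t - pgf θ t -
          pgf θ t * ∑ k, gradVec θ t k * (θ' - (θ : Param)) k)) -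
        ∑ k, pgf θ t * gradVec θ t k *
          (√(n : ℝ) • (θ' - (θ : Param)) - normalizedSum (fun y => ℓ y θ) x) k := by
  have hn : √(n : ℝ) * (1 / n) = 1 / √(n : ℝ) := by
    rw [mul_one_div, Real.sqrt_div_self']
  have hn' : 1 / √(n : ℝ) * n = √(n : ℝ) := by
    rw [one_div_mul_eq_div, Real.div_sqrt]
  have hsum (k : Fin 5) : (normalizedSum (fun y => ℓ y θ) x) k =
      1 / √(n : ℝ) * ∑ i, ℓ (x i) θ k := by
    simp [normalizedSum]
  have hW : W ℓ θ x t = 1 / √(n : ℝ) * ∑ i, t.1 ^ (x i).1 * t.2 ^ (x i).2 -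
      √(n : ℝ) * pgf θ t - ∑ k, pgf θ t * gradVec θ t k *
        (1 / √(n : ℝ) * ∑ i, ℓ (x i) θ k) := by
    simp only [W, V0, mul_add, mul_one, Finset.sum_sub_distrib, Finset.sum_add_distrib,
      Finset.sum_const, Finset.card_univ, Fintype.card_fin, nsmul_eq_mul, mul_sub]
    rw [← mul_assoc, hn', sub_sub]
    congr 2
    simp only [Finset.mul_sum]
    rw [Finset.sum_comm]
    exact Finset.sum_congr rfl fun k _ => Finset.sum_congr rfl fun i _ => by ring
  rw [hW, empProcess, epgf, mul_sub, ← mul_assoc, hn]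
  simp only [PiLp.sub_apply, PiLp.smul_apply, smul_eq_mul, hsum, mul_sub, Finset.sum_sub_distrib,
    Finset.mul_sum]
  have : ∀ a b : Fin 5 → ℝ, (∀ k, a k = b k) → ∑ k, a k = ∑ k, b k :=
    fun a b h => Finset.sum_congr rfl fun k _ => h k
  rw [this (fun k => pgf θ t * gradVec θ t k * (√(n : ℝ) * θ' k))
      (fun k => √(n : ℝ) * (pgf θ t * (gradVec θ t k * θ' k))) fun k => by ring,
    this (fun k => pgf θ t * gradVec θ t k * (√(n : ℝ) * (θ : Param) k))
      (fun k => √(n : ℝ) * (pgf θ t * (gradVec θ t k * (θ : Param) k))) fun k => by ring]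
  ring

variable {m : Measure (ℝ × ℝ)} [IsFiniteMeasure m] {ν : Measure (ℕ × ℕ)}

/-- The random element `V⁰(x; θ; ·)` of `L²(m)`. -/
def V0L2 (hm : ∀ᵐ t ∂m, t ∈ unitSquare) (x : ℕ × ℕ) : Lp ℝ 2 m := toL2 hm (V0Map ℓ θ x)

lemma normalizedSum_V0L2 (hm : ∀ᵐ t ∂m, t ∈ unitSquare) {n : ℕ} (x : Fin n → ℕ × ℕ) :
    normalizedSum (V0L2 ℓ θ hm) x = toL2 hm (WMap ℓ θ x) := by
  simp [normalizedSum, V0L2, WMap]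

lemma memLp_monomial [IsProbabilityMeasure ν] (hm : ∀ᵐ t ∂m, t ∈ unitSquare) :
    MemLp (fun x => toL2 hm (monomialMap x)) 2 ν :=
  MemLp.of_bound .of_discrete _ (ae_of_all _ fun x => norm_toL2_le hm zero_le_one fun _ ht =>
    abs_pow_mul_pow_le_one ht x)

/-- The vector-valued mean is identified by testing against every `c` in `L²(m)`: Fubini reduces it
to the pointwise generating function. -/
lemma integral_monomial [IsProbabilityMeasure ν] (hm : ∀ᵐ t ∂m, t ∈ unitSquare)
    (hν : IsBivariateHermite θ ν) :
    ∫ x, toL2 hm (monomialMap x) ∂ν = toL2 hm (pgfMap θ) := by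
  have hint : Integrable (fun x => toL2 hm (monomialMap x)) ν :=
    (memLp_monomial hm).integrable (by norm_num)
  rw [← sub_eq_zero]
  have h0 : ∀ c : Lp ℝ 2 m, inner ℝ c (∫ x, toL2 hm (monomialMap x) ∂ν - toL2 hm (pgfMap θ)) = 0 := by
    intro c
    rw [inner_sub_right, ← integral_inner hint, sub_eq_zero]
    simp_rw [inner_left_toL2]
    rw [integral_integral_swap]
    · refine integral_congr_ae (hm.mono fun t ht => ?_)
      simp only
      rw [integral_const_mul]
      exact congrArg _ (integral_pow_mul_pow θ.2.1 hν ht)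
    · have hc : Integrable c m := (Lp.memLp c).integrable (by norm_num)
      refine (hc.comp_snd ν).mul_bdd (c := 1) ?_ ?_
      · refine Measurable.aestronglyMeasurable ?_
        change Measurable fun p : (ℕ × ℕ) × (ℝ × ℝ) => p.2.1 ^ p.1.1 * p.2.2 ^ p.1.2
        fun_prop
      · have : ∀ᵐ p ∂(ν.prod m), p.2 ∈ unitSquare :=
          Measure.quasiMeasurePreserving_snd.ae hm
        exact this.mono fun p hp => abs_pow_mul_pow_le_one hp p.1
  exact inner_self_eq_zero.1 (h0 _)

variable {ℓ θ}

lemma memLp_influence (h2 : ∀ a b : Fin 5, Integrable (fun x => ℓ x θ a * ℓ x θ b) ν) :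
    MemLp (fun x => ℓ x θ) 2 ν := by
  refine MemLp.of_eval_piLp fun k => (memLp_two_iff_integrable_sq .of_discrete).2 ?_
  simpa [sq] using h2 k k

lemma memLp_V0L2 [IsProbabilityMeasure ν] (hm : ∀ᵐ t ∂m, t ∈ unitSquare)
    (hℓ : MemLp (fun x => ℓ x θ) 2 ν) : MemLp (V0L2 ℓ θ hm) 2 ν := by
  have : V0L2 ℓ θ hm = fun x => toL2 hm (monomialMap x) - toL2 hm (pgfMap θ) -
      ∑ k, ℓ x θ k • toL2 hm (gradMap θ k) := by
    funext x; simp [V0L2, V0Map]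
  rw [this]
  refine ((memLp_monomial hm).sub (memLp_const _)).sub (memLp_finsetSum _ fun k _ => ?_)
  exact (MemLp.of_le_mul (c := ‖toL2 hm (gradMap θ k)‖) (hℓ.eval_piLp k) .of_discrete
    (ae_of_all _ fun x => by rw [norm_smul, mul_comm]))

lemma integral_V0L2 [IsProbabilityMeasure ν] (hm : ∀ᵐ t ∂m, t ∈ unitSquare)
    (hν : IsBivariateHermite θ ν) (hℓ : MemLp (fun x => ℓ x θ) 2 ν) (h0 : ∫ x, ℓ x θ ∂ν = 0) :
    ∫ x, V0L2 ℓ θ hm x ∂ν = 0 := by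
  have : V0L2 ℓ θ hm = fun x => toL2 hm (monomialMap x) - toL2 hm (pgfMap θ) -
      ∑ k, ℓ x θ k • toL2 hm (gradMap θ k) := by
    funext x; simp [V0L2, V0Map]
  have hi1 : Integrable (fun x => toL2 hm (monomialMap x)) ν :=
    (memLp_monomial hm).integrable (by norm_num)
  have hk (k : Fin 5) : Integrable (fun x => ℓ x θ k) ν := (hℓ.eval_piLp k).integrable (by norm_num)
  have hk0 (k : Fin 5) : ∫ x, ℓ x θ k ∂ν = 0 := by
    have := (EuclideanSpace.proj (𝕜 := ℝ) k).integral_comp_comm (hℓ.integrable (by norm_num))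
    rw [h0, map_zero] at this
    exact this
  rw [this]
  change ∫ x, (toL2 hm (monomialMap x) - toL2 hm (pgfMap θ) -
      ∑ k, ℓ x θ k • toL2 hm (gradMap θ k)) ∂ν = 0
  have hi2 : Integrable (fun x => toL2 hm (monomialMap x) - toL2 hm (pgfMap θ)) ν :=
    hi1.sub (integrable_const _)
  rw [integral_sub hi2
    (integrable_finsetSum _ fun k _ => (hk k).smul_const _), integral_sub hi1 (integrable_const _),
    integral_monomial θ hm hν, integral_finsetSum _ fun k _ => (hk k).smul_const _]
  simp [integral_smul_const, hk0]

end Influence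

/-! ### Replacing the estimator by its linear expansion. -/

section Expansion

variable {ℓ : ℕ × ℕ → parameterSpace → Param} {θ : parameterSpace} {m : Measure (ℝ × ℝ)}
  [IsFiniteMeasure m]

/-- The distance in `L²(m)` of the empirical process with estimated parameter `θ'` from `Wₙ`, in
terms of the remainder of the linear expansion of `θ'`. -/
lemma exists_norm_empMap_sub_WMap_le (hm : ∀ᵐ t ∂m, t ∈ unitSquare) :
    ∃ C ≥ 0, ∃ ρ > 0, ∀ (n : ℕ) (x : Fin n → ℕ × ℕ) (θ' : Param), ‖θ' - θ‖ ≤ ρ →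
      ‖toL2 hm (empMap x θ') - toL2 hm (WMap ℓ θ x)‖ ≤
        C * (√(n : ℝ) * ‖θ' - θ‖ ^ 2 +
          ‖√(n : ℝ) • (θ' - (θ : Param)) - normalizedSum (fun y => ℓ y θ) x‖) := by
  obtain ⟨C, hC, ρ, hρ, h⟩ := exists_abs_pgf_sub_le θ
  obtain ⟨A, hA⟩ := isCompact_unitSquare.exists_bound_of_continuousOn
    (f := fun t => ∑ k, |gradMap θ k t|) (by fun_prop)
  have hA0 : 0 ≤ A := (norm_nonneg _).trans (hA (0, 0) (by simp [unitSquare]))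
  set κ := (measureUnivNNReal m : ℝ) ^ (2 : ENNReal).toReal⁻¹ with hκ
  have hκ0 : 0 ≤ κ := by positivity
  refine ⟨κ * (C + A), by positivity, ρ, hρ, fun n x θ' hθ' => ?_⟩
  set D := ‖θ' - θ‖
  set r := √(n : ℝ) • (θ' - (θ : Param)) - normalizedSum (fun y => ℓ y θ) x with hr
  rw [← map_sub]
  have hbound : ∀ t ∈ unitSquare, |(empMap x θ' - WMap ℓ θ x) t| ≤
      √(n : ℝ) * (C * D ^ 2) + A * ‖r‖ := by
    intro t ht
    rw [ContinuousMap.sub_apply, empMap_apply, WMap_apply, empProcess_sub_W, ← hr]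
    refine (abs_sub _ _).trans (add_le_add ?_ ?_)
    · rw [abs_neg, abs_mul, abs_of_nonneg (Real.sqrt_nonneg _)]
      gcongr
      exact h θ' hθ' t ht
    · refine (Finset.abs_sum_le_sum_abs _ _).trans ?_
      calc _ ≤ ∑ k, |gradMap θ k t| * ‖r‖ := by
            gcongr with k
            rw [abs_mul]
            exact mul_le_mul_of_nonneg_left (PiLp.norm_apply_le r k) (abs_nonneg _)
        _ = (∑ k, |gradMap θ k t|) * ‖r‖ := by rw [Finset.sum_mul]
        _ ≤ _ := by
            gcongr
            exact (le_abs_self _).trans (hA t ht)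
  refine (norm_toL2_le hm (by positivity) hbound).trans ?_
  rw [← hκ, mul_assoc κ]
  gcongr
  have h1 : 0 ≤ √(n : ℝ) * D ^ 2 := by positivity
  have h2 : 0 ≤ ‖r‖ := norm_nonneg _
  nlinarith [mul_nonneg hA0 h1, mul_nonneg hC h2]

lemma abs_norm_sq_sub_norm_sq_le {H : Type*} [NormedAddCommGroup H] (a b : H) :
    |‖a‖ ^ 2 - ‖b‖ ^ 2| ≤ ‖a - b‖ * (‖a - b‖ + 2 * ‖b‖) := by
  rw [sq_sub_sq, abs_mul, mul_comm, abs_of_nonneg (add_nonneg (norm_nonneg a) (norm_nonneg b))]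
  have h1 := abs_norm_sub_norm_le a b
  have h2 : ‖a‖ ≤ ‖a - b‖ + ‖b‖ := norm_le_norm_sub_add a b
  exact mul_le_mul h1 (by linarith) (by positivity) (norm_nonneg _)

variable {Ω : Type*} [MeasurableSpace Ω] {P : Measure Ω} [IsProbabilityMeasure P]
  {ν : Measure (ℕ × ℕ)} [IsProbabilityMeasure ν] {X : ℕ → Ω → ℕ × ℕ}

/-- Replacing the estimator by its linear expansion changes the squared norm of the empirical
process by a term which tends to `0` in probability. -/
theorem tendstoInMeasure_norm_sq_sub (hm : ∀ᵐ t ∂m, t ∈ unitSquare)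
    (hX : ∀ i, HasLaw (X i) ν P) (hi : iIndepFun X P) (hν : IsBivariateHermite θ ν)
    {θhat : (n : ℕ) → (Fin n → ℕ × ℕ) → Param} (hlin : AsymptoticallyLinear P X ν θhat ℓ θ) :
    TendstoInMeasure P (fun (n : ℕ) ω =>
      ‖toL2 hm (empMap (sample X n ω) (θhat n (sample X n ω)))‖ ^ 2 -
        ‖toL2 hm (WMap ℓ θ (sample X n ω))‖ ^ 2) atTop (fun _ => 0) := by
  have hℓ := memLp_influence hlin.secondMoment_finite
  have hV := memLp_V0L2 hm hℓ
  have hV0 := integral_V0L2 hm hν hℓ hlin.mean_zero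
  have hL := integral_norm_sq_normalizedSum_le hX hi hℓ hlin.mean_zero
  have hQ := integral_norm_sq_normalizedSum_le hX hi hV hV0
  obtain ⟨C, hC, ρ, hρ, hbd⟩ := exists_norm_empMap_sub_WMap_le (ℓ := ℓ) (θ := θ) hm
  refine tendstoInMeasure_zero_of_bounded
    (U := fun n ω => ‖√(n : ℝ) • (θhat n (sample X n ω) - (θ : Param)) -
      normalizedSum (fun y => ℓ y θ) (sample X n ω)‖)
    (S := fun n ω => ‖normalizedSum (fun y => ℓ y θ) (sample X n ω)‖ ^ 2 +
      ‖normalizedSum (V0L2 ℓ θ hm) (sample X n ω)‖ ^ 2)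
    (K := ∫ x, ‖ℓ x θ‖ ^ 2 ∂ν + ∫ x, ‖V0L2 ℓ θ hm x‖ ^ 2 ∂ν) ?_ (fun n ω => by positivity)
    (fun n => (hL n).1.add (hQ n).1)
    (fun n => by rw [integral_add (hL n).1 (hQ n).1]; exact add_le_add (hL n).2 (hQ n).2) ?_
  · have := hlin.expansion
    rw [tendstoInMeasure_iff_norm] at this ⊢
    simpa [normalizedSum] using this
  · intro M ε hM hε
    -- `τ` is the target distance in `L²(m)`: with `‖a - b‖ ≤ τ ≤ 1` and `‖b‖ ≤ M + 1`, the squared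
    -- norms differ by at most `τ * (1 + 2 * (M + 1))`. Half of `τ` is allotted to the linear
    -- remainder, through `δ`, and half to the Taylor remainder, through `N`.
    obtain ⟨τ, hτ0, hτ1, hτε⟩ : ∃ τ > 0, τ ≤ 1 ∧ τ * (1 + 2 * (M + 1)) < ε := by
      refine ⟨min 1 (ε / (2 * (1 + 2 * (M + 1)))), by positivity, min_le_left _ _, ?_⟩
      calc _ ≤ ε / (2 * (1 + 2 * (M + 1))) * (1 + 2 * (M + 1)) := by
            gcongr; exact min_le_right _ _
        _ = ε / 2 := by field_simp
        _ < ε := by linarith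
    obtain ⟨δ, hδ0, hδ1, hδτ⟩ : ∃ δ > 0, δ ≤ 1 ∧ C * δ ≤ τ / 2 := by
      refine ⟨min 1 (τ / (2 * (C + 1))), by positivity, min_le_left _ _, ?_⟩
      calc _ ≤ (C + 1) * (τ / (2 * (C + 1))) := by
            gcongr
            · linarith
            · exact min_le_right _ _
        _ = τ / 2 := by field_simp
    have hsq : Tendsto (fun n : ℕ => (√(n : ℝ))⁻¹) atTop (𝓝 0) :=
      tendsto_inv_atTop_zero.comp (Real.tendsto_sqrt_atTop.comp tendsto_natCast_atTop_atTop)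
    have h1 : Tendsto (fun n : ℕ => (M + 2) * (√(n : ℝ))⁻¹) atTop (𝓝 0) := by
      simpa using hsq.const_mul (M + 2)
    have h2 : Tendsto (fun n : ℕ => C * (M + 2) ^ 2 * (√(n : ℝ))⁻¹) atTop (𝓝 0) := by
      simpa using hsq.const_mul (C * (M + 2) ^ 2)
    obtain ⟨N, hN⟩ := eventually_atTop.1 (((h1.eventually (gt_mem_nhds hρ)).and
      (h2.eventually (gt_mem_nhds (half_pos hτ0)))).and (eventually_gt_atTop 0))
    refine ⟨δ, hδ0, N, fun n hn ω hU hS => ?_⟩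
    obtain ⟨⟨hn1, hn2⟩, hn0⟩ := hN n hn
    set Δ := θhat n (sample X n ω) - (θ : Param) with hΔ
    set L := normalizedSum (fun y => ℓ y θ) (sample X n ω) with hLdef
    set Q := normalizedSum (V0L2 ℓ θ hm) (sample X n ω) with hQdef
    have hs0 : 0 < √(n : ℝ) := Real.sqrt_pos.2 (Nat.cast_pos.2 hn0)
    rw [abs_norm] at hU
    -- `‖L‖² < M` implies `‖L‖ ≤ M + 1`, which avoids `√M`.
    have hLM : ‖L‖ ≤ M + 1 := by nlinarith [norm_nonneg L, sq_nonneg ‖Q‖]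
    have hQM : ‖Q‖ ≤ M + 1 := by nlinarith [norm_nonneg Q, sq_nonneg ‖L‖]
    have hΔM : √(n : ℝ) * ‖Δ‖ ≤ M + 2 := by
      calc √(n : ℝ) * ‖Δ‖ = ‖√(n : ℝ) • Δ‖ := by
            rw [norm_smul, Real.norm_of_nonneg hs0.le]
        _ ≤ ‖√(n : ℝ) • Δ - L‖ + ‖L‖ := norm_le_norm_sub_add _ _
        _ ≤ _ := by linarith
    have hΔ1 : ‖Δ‖ ≤ (M + 2) * (√(n : ℝ))⁻¹ := by
      rw [← div_eq_mul_inv, le_div_iff₀ hs0, mul_comm]; exact hΔM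
    have hΔ2 : √(n : ℝ) * ‖Δ‖ ^ 2 ≤ (M + 2) ^ 2 * (√(n : ℝ))⁻¹ := by
      calc √(n : ℝ) * ‖Δ‖ ^ 2 = (√(n : ℝ) * ‖Δ‖) * ‖Δ‖ := by ring
        _ ≤ (M + 2) * ((M + 2) * (√(n : ℝ))⁻¹) := by gcongr
        _ = _ := by ring
    have hdist := hbd n (sample X n ω) (θhat n (sample X n ω)) (hΔ1.trans hn1.le)
    have hle : ‖toL2 hm (empMap (sample X n ω) (θhat n (sample X n ω))) -
        toL2 hm (WMap ℓ θ (sample X n ω))‖ ≤ τ := by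
      refine hdist.trans ?_
      rw [mul_add]
      have e1 : C * (√(n : ℝ) * ‖Δ‖ ^ 2) ≤ τ / 2 := by
        refine (mul_le_mul_of_nonneg_left hΔ2 hC).trans ?_
        rw [← mul_assoc]; exact hn2.le
      have e2 : C * ‖√(n : ℝ) • Δ - L‖ ≤ τ / 2 :=
        (mul_le_mul_of_nonneg_left hU.le hC).trans hδτ
      linarith
    refine (abs_norm_sq_sub_norm_sq_le _ _).trans_lt (lt_of_le_of_lt ?_ hτε)
    rw [← normalizedSum_V0L2, ← hQdef] at hle ⊢
    gcongr
    linarith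

end Expansion

/-! ### The statistic, `‖Wₙ‖²` and the kernel `h` in terms of `L²(m)`. -/

section StatisticAsNorm

variable {w : ℝ × ℝ → ℝ}
  (ℓ : ℕ × ℕ → parameterSpace → Param) (θ : parameterSpace) [IsFiniteMeasure (weightMeasure w)]

lemma cvmStatistic_eq (hw0 : ∀ t ∈ unitSquare, 0 ≤ w t) (hw : IntegrableOn w unitSquare)
    {n : ℕ} (x : Fin n → ℕ × ℕ) (θ' : Param) :
    cvmStatistic w x θ' = ‖toL2 (ae_mem_unitSquare w) (empMap x θ')‖ ^ 2 := by
  rw [norm_sq_toL2, integral_weightMeasure hw0 hw]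
  simp_rw [empMap_apply]
  rfl

lemma normSqH_W_eq (hw0 : ∀ t ∈ unitSquare, 0 ≤ w t) (hw : IntegrableOn w unitSquare)
    {n : ℕ} (x : Fin n → ℕ × ℕ) :
    normSqH w (W ℓ θ x) = ‖toL2 (ae_mem_unitSquare w) (WMap ℓ θ x)‖ ^ 2 := by
  rw [norm_sq_toL2, integral_weightMeasure hw0 hw]
  simp_rw [WMap_apply]
  rfl

lemma kernelH_eq (hw0 : ∀ t ∈ unitSquare, 0 ≤ w t) (hw : IntegrableOn w unitSquare) :
    kernelH w ℓ θ = fun x y =>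
    inner ℝ (V0L2 ℓ θ (ae_mem_unitSquare w) x) (V0L2 ℓ θ (ae_mem_unitSquare w) y) := by
  funext x y
  rw [V0L2, V0L2, inner_toL2_toL2, integral_weightMeasure hw0 hw]
  simp_rw [V0Map_apply]
  rfl

end StatisticAsNorm

end BivariateHermite

end

theorem theorem1 {Ω : Type*} [MeasurableSpace Ω] (P : Measure Ω) [IsProbabilityMeasure P]
    (θ : BivariateHermite.parameterSpace)
    (ν : Measure (ℕ × ℕ)) (hν : BivariateHermite.IsBivariateHermite θ ν)
    (X : ℕ → Ω → ℕ × ℕ) (hX_law : ∀ i, HasLaw (X i) ν P) (hX_indep : iIndepFun X P)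
    (w : ℝ × ℝ → ℝ) (hw_nonneg : ∀ t ∈ BivariateHermite.unitSquare, 0 ≤ w t)
    (hw_int : IntegrableOn w BivariateHermite.unitSquare)
    (θhat : (n : ℕ) → (Fin n → ℕ × ℕ) → BivariateHermite.Param)
    (ℓ : ℕ × ℕ → BivariateHermite.parameterSpace → BivariateHermite.Param)
    (hlin : BivariateHermite.AsymptoticallyLinear P X ν θhat ℓ θ) :
    -- the statistic and the norm of `Wₙ` are honest finite integrals
    (∀ (n : ℕ) (x : Fin n → ℕ × ℕ),
      BivariateHermite.MemH w (BivariateHermite.empProcess x (θhat n x)) ∧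
      BivariateHermite.MemH w (BivariateHermite.W ℓ θ x)) ∧
    -- `V_{n,w}(θ̂ₙ) = ‖Wₙ‖² + o_P(1)`
    TendstoInMeasure P
      (fun (n : ℕ) ω =>
        BivariateHermite.cvmStatistic w (BivariateHermite.sample X n ω)
            (θhat n (BivariateHermite.sample X n ω)) -
          BivariateHermite.normSqH w
            (BivariateHermite.W ℓ θ (BivariateHermite.sample X n ω)))
      atTop (fun _ => 0) ∧
    -- the non-null eigenvalues of `C(θ)` can be listed in a sequence, with multiplicities
    (∃ e : ℕ → ℝ, BivariateHermite.EnumeratesNonzeroEigenvalues ν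
      (BivariateHermite.kernelH w ℓ θ) e) ∧
    -- `V_{n,w}(θ̂ₙ)` converges in law to `∑ⱼ λⱼ χ²₁ⱼ`, a series that converges almost surely
    (∀ e : ℕ → ℝ, BivariateHermite.EnumeratesNonzeroEigenvalues ν
        (BivariateHermite.kernelH w ℓ θ) e →
      ∀ {Ω' : Type*} [MeasurableSpace Ω'] (P' : Measure Ω') [IsProbabilityMeasure P']
        (Z : ℕ → Ω' → ℝ), (∀ j, HasLaw (Z j) BivariateHermite.chiSquareOne P') →
        iIndepFun Z P' →
        (∀ᵐ ω' ∂P', Summable fun j => e j * Z j ω') ∧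
        TendstoInDistribution
          (fun (n : ℕ) ω =>
            BivariateHermite.cvmStatistic w (BivariateHermite.sample X n ω)
              (θhat n (BivariateHermite.sample X n ω)))
          atTop (fun ω' => ∑' j, e j * Z j ω') (fun _ => P) P') := by
  have hν' : IsProbabilityMeasure ν := hν.1
  have hfin := BivariateHermite.isFiniteMeasure_weightMeasure hw_int
  have hm := BivariateHermite.ae_mem_unitSquare w
  have hℓ := BivariateHermite.memLp_influence hlin.secondMoment_finite
  have hV := BivariateHermite.memLp_V0L2 hm hℓ
  have hV0 := BivariateHermite.integral_V0L2 hm hν hℓ hlin.mean_zero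
  have hsub := BivariateHermite.tendstoInMeasure_norm_sq_sub hm hX_law hX_indep hν hlin
  simp_rw [BivariateHermite.cvmStatistic_eq hw_nonneg hw_int,
    BivariateHermite.normSqH_W_eq ℓ θ hw_nonneg hw_int,
    BivariateHermite.kernelH_eq ℓ θ hw_nonneg hw_int]
  refine ⟨fun n x => ⟨BivariateHermite.memH_of_continuous hw_int ?_,
    BivariateHermite.memH_of_continuous hw_int ?_⟩, hsub,
    BivariateHermite.exists_enumeration hV, fun e he Ω' _ P' _ Z hZ hZi => ?_⟩
  · rw [← funext (BivariateHermite.empMap_apply x (θhat n x))]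
    exact ContinuousMap.continuous _
  · rw [← funext (BivariateHermite.WMap_apply ℓ θ x)]
    exact ContinuousMap.continuous _
  obtain ⟨ψ, hψ⟩ := BivariateHermite.exists_isEigenSystem hV he
  refine ⟨BivariateHermite.ae_summable_mul_chiSquare (hψ.nonneg hV)
    (hψ.hasSum_eigenvalues hV).summable hZ, ?_⟩
  have hlim := BivariateHermite.tendstoInDistribution_norm_sq_normalizedSum hX_law hX_indep hV hV0
    hψ hZ hZi
  simp_rw [BivariateHermite.normalizedSum_V0L2] at hlim
  -- Slutsky: the statistic inherits the limit law of `‖Wₙ‖²`.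
  exact tendstoInDistribution_of_tendstoInMeasure_sub _ _ hlim hsub
    fun n => BivariateHermite.aemeasurable_comp_sample hX_law
      fun x => ‖BivariateHermite.toL2 hm (BivariateHermite.empMap x (θhat n x))‖ ^ 2
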